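/- Let $\mathbb K$ be a field of characteristic zero. All operads are symmetric operads in $\mathbb K$-vector spaces. For an $S_2$-module $E$ let $\mathcal F(E)$ be the free operad on $E$ placed in arity $2$; for a sub-$S_3$-module $R\subseteq\mathcal F(E)(3)$ let $\mathcal P(E,R)=\mathcal F(E)/(R)$, where $(R)$ is the operadic ideal generated by $R$. Put $E^\vee=E^*\otimes\mathrm{sgn}$. If $E$ is finite-dimensional, identify $\mathcal F(E)(3)$ with three copies of $E\otimes E$, the element $\mu\otimes\nu$ of the three copies corresponding to $\mu(\nu(x_1,x_2),x_3)$, $\mu(\nu(x_2,x_3),x_1)$, $\mu(\nu(x_3,x_1),x_2)$, and likewise for $E^\vee$; let $R^\perp\subseteq\mathcal F(E^\vee)(3)$ be the orthogonal complement of $R$ for the pairing in which different copies are orthogonal and $\langle\alpha\otimes\beta,\mu\otimes\nu\rangle=\alpha(\mu)\beta(\nu)$ on equal copies. The Koszul dual of $\mathcal P(E,R)$ is $\mathcal P(E,R)^!=\mathcal P(E^\vee,R^\perp)$. Let $E=\mathbb K[S_2]$ be spanned by one binary operation $a\cdot b$ without symmetry and its opposite, and let $[a,b]=a\cdot b-b\cdot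 a$ and $a\diamond b=a\cdot b+b\cdot a$, a basis of $E$ with dual basis $[\,,]^*,\diamond^*$ of $E^\vee$. Let $\mathrm{sLeib}=\mathcal P(E,R)$, with $R$ the $S_3$-submodule generated by the left and right Leibniz identities $$a\cdot(b\cdot c)=(a\cdot b)\cdot c+b\cdot(a\cdot c),\qquad (a\cdot b)\cdot c=a\cdot(b\cdot c)+(a\cdot c)\cdot b,$$ and let $\mathrm{ComAdm}=\mathcal P(E,R')$, with $R'$ the $S_3$-submodule generated by the associativity relation $(a\diamond b)\diamond c-a\diamond(b\diamond c)$. Then: 1. The maps from three copies of $E\otimes E$ to $\mathcal F(E)(3)$, and of $E^\vee\otimes E^\vee$ to $\mathcal F(E^\vee)(3)$, described above are indeed bijective, and $\dim\mathcal F(E)(3)=12$, $\dim R=10$, $\dim R^\perp=2$. 2. The element $s=[\,,]^*\in E^\vee$ is symmetric, and $R^\perp$ is spanned by $t-(123)t$ and $t-(321)t$, where $t=s(s(x_1,x_2),x_3)$; equivalently, $R^\perp$ is the $S_3$-submodule generated by the associator $s(s(x_1,x_2),x_3)-s(x_1,s(x_2,x_3))$. 3. There is an isomorphism of operads $\mathrm{sLeib}^!\cong\mathrm{ComAdm}$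 with $[\,,]^*\mapsto\diamond$ and $\diamond^*\mapsto[\,,]$. 4. For each $\mathbb K$-vector space $A$, sending an algebra structure (a morphism of operads to the endomorphism operad of $A$) to the bilinear multiplication given by the generator $a\cdot b$ is a bijection from the $\mathrm{sLeib}$-algebra structures on $A$ to the symmetric Leibniz multiplications (those satisfying both identities above), and from the $\mathrm{ComAdm}$-algebra structures on $A$ to the com.-admissible multiplications (those for which $a\diamond b=a\cdot b+b\cdot a$ is commutative and associative). -/

import Mathlib

open scoped TensorProduct

universe u v w v₁ v₂

noncomputable section

/-! ### Symmetric operads -/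

/-- A symmetric operad in `K`-vector spaces, in its coordinate-free form: a functor `I ↦ P(I)` from
finite sets and bijections to vector spaces (`relabel`; for `I = Fin n` this is the action of the
symmetric group on the `n`-ary operations), a unit in `P({*})`, and compositions
`P(I) ⊗ ⨂_{i ∈ I} P(J i) → P(Σ_i J i)`, natural in all arguments, unital and associative. -/
structure SymOperad (K : Type u) [Field K] where
  /-- operations whose inputs are labelled by the finite set `I` -/
  obj : (I : Type) → [Finite I] → Type v
  [acg : ∀ (I : Type) [Finite I], AddCommGroup (obj I)]
  [mod : ∀ (I : Type) [Finite I], Module K (obj I)]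
  /-- the input labelled `i` gets the new label `σ i` -/
  relabel : ∀ {I J : Type} [Finite I] [Finite J], (I ≃ J) → obj I →ₗ[K] obj J
  one : obj Unit
  /-- insert the output of `q i` into the input `i` of `p`, for all `i` -/
  comp : ∀ {I : Type} [Finite I] {J : I → Type} [∀ i, Finite (J i)],
    obj I →ₗ[K] MultilinearMap K (fun i => obj (J i)) (obj (Σ i, J i))
  relabel_refl : ∀ {I : Type} [Finite I] (p : obj I), relabel (Equiv.refl I) p = p
  relabel_trans : ∀ {I J L : Type} [Finite I] [Finite J] [Finite L] (σ : I ≃ J) (τ : J ≃ L)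
    (p : obj I), relabel (σ.trans τ) p = relabel τ (relabel σ p)
  comp_relabel_left : ∀ {I I' : Type} [Finite I] [Finite I'] {J : I' → Type}
    [∀ i, Finite (J i)] (σ : I ≃ I') (p : obj I) (q : ∀ i, obj (J i)),
    comp (relabel σ p) q =
      relabel (Equiv.sigmaCongrLeft (β := J) σ) (comp p (fun i => q (σ i)))
  comp_relabel_right : ∀ {I : Type} [Finite I] {J J' : I → Type} [∀ i, Finite (J i)]
    [∀ i, Finite (J' i)] (τ : ∀ i, J i ≃ J' i) (p : obj I) (q : ∀ i, obj (J i)),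
    comp p (fun i => relabel (τ i) (q i)) = relabel (Equiv.sigmaCongrRight τ) (comp p q)
  one_comp : ∀ {J : Type} [Finite J] (q : obj J),
    relabel (Equiv.uniqueSigma (fun _ : Unit => J)) (comp one (fun _ : Unit => q)) = q
  comp_one : ∀ {I : Type} [Finite I] (p : obj I),
    relabel (Equiv.sigmaUnique I (fun _ => Unit)) (comp p (fun _ : I => one)) = p
  comp_assoc : ∀ {I : Type} [Finite I] {J : I → Type} [∀ i, Finite (J i)]
    {L : ∀ i, J i → Type} [∀ i j, Finite (L i j)]
    (p : obj I) (q : ∀ i, obj (J i)) (r : ∀ i j, obj (L i j)),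
    relabel (Equiv.sigmaAssoc L)
        (comp (J := fun x : Σ i, J i => L x.1 x.2) (comp p q) (fun x => r x.1 x.2)) =
      comp p (fun i => comp (q i) (r i))

attribute [instance] SymOperad.acg SymOperad.mod

namespace SymOperad

variable {K : Type u} [Field K]

/-- Morphisms of operads. -/
structure Hom (P : SymOperad.{u, v₁} K) (Q : SymOperad.{u, v₂} K) where
  app : ∀ (I : Type) [Finite I], P.obj I →ₗ[K] Q.obj I
  app_relabel : ∀ {I J : Type} [Finite I] [Finite J] (σ : I ≃ J) (p : P.obj I),
    app J (P.relabel σ p) = Q.relabel σ (app I p)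
  app_one : app Unit P.one = Q.one
  app_comp : ∀ {I : Type} [Finite I] {J : I → Type} [∀ i, Finite (J i)]
    (p : P.obj I) (q : ∀ i, P.obj (J i)),
    app (Σ i, J i) (P.comp p q) = Q.comp (app I p) (fun i => app (J i) (q i))

/-- A morphism of operads is an isomorphism if it is bijective in each arity. -/
def Hom.IsIso {P : SymOperad.{u, v₁} K} {Q : SymOperad.{u, v₂} K} (f : Hom P Q) : Prop :=
  ∀ (I : Type) [Finite I], Function.Bijective (f.app I)

/-! ### The endomorphism operad -/

/-- Composition of multilinear maps: `f(g i (x i j)_j)_i`. -/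
def endComp (K : Type u) [Field K] (A : Type w) [AddCommGroup A] [Module K A] {I : Type}
    {J : I → Type} :
    MultilinearMap K (fun _ : I => A) A →ₗ[K]
      MultilinearMap K (fun i => MultilinearMap K (fun _ : J i => A) A)
        (MultilinearMap K (fun _ : Σ i, J i => A) A) where
  toFun f :=
    { toFun := fun g => f.compMultilinearMap g
      map_update_add' := by
        intro _ g i x y
        ext m
        have h : ∀ z : MultilinearMap K (fun _ : J i => A) A,
            (fun j => (Function.update g i z j) (fun k => m ⟨j, k⟩)) =
            Function.update (fun j => g j (fun k => m ⟨j, k⟩)) i (z (fun k => m ⟨i, k⟩)) := by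
          intro z; funext j
          by_cases hj : j = i
          · subst hj; simp
          · simp [hj]
        change f (fun j => (Function.update g i (x + y) j) (fun k => m ⟨j, k⟩)) =
          f (fun j => (Function.update g i x j) (fun k => m ⟨j, k⟩)) +
          f (fun j => (Function.update g i y j) (fun k => m ⟨j, k⟩))
        rw [h, h, h]
        exact f.map_update_add _ _ _ _
      map_update_smul' := by
        intro _ g i c x
        ext m
        have h : ∀ z : MultilinearMap K (fun _ : J i => A) A,
            (fun j => (Function.update g i z j) (fun k => m ⟨j, k⟩)) =
            Function.update (fun j => g j (fun k => m ⟨j, k⟩)) i (z (fun k => m ⟨i, k⟩)) := by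
          intro z; funext j
          by_cases hj : j = i
          · subst hj; simp
          · simp [hj]
        change f (fun j => (Function.update g i (c • x) j) (fun k => m ⟨j, k⟩)) =
          c • f (fun j => (Function.update g i x j) (fun k => m ⟨j, k⟩))
        rw [h, h]
        exact f.map_update_smul _ _ _ _ }
  map_add' _ _ := rfl
  map_smul' _ _ := rfl

/-- The endomorphism operad of a vector space `A`. A structure of a `P`-algebra on `A` is a
morphism of operads from `P` to it. -/
def endOperad (K : Type u) [Field K] (A : Type w) [AddCommGroup A] [Module K A] :
    SymOperad.{u, w} K where
  obj I _ := MultilinearMap K (fun _ : I => A) A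
  relabel σ := (MultilinearMap.domDomCongrLinearEquiv K K A A σ).toLinearMap
  one := LinearMap.id.compMultilinearMap (MultilinearMap.ofSubsingleton K A A () LinearMap.id)
  comp := endComp K A
  relabel_refl _ := rfl
  relabel_trans _ _ _ := rfl
  comp_relabel_left _ _ _ := rfl
  comp_relabel_right _ _ _ := rfl
  one_comp _ := rfl
  comp_one _ := rfl
  comp_assoc _ _ _ := rfl

/-! ### Operadic ideals and quotients -/

/-- Operadic ideals. -/
structure Ideal (P : SymOperad.{u, v} K) where
  carrier : ∀ (I : Type) [Finite I], Submodule K (P.obj I)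
  relabel_mem : ∀ {I J : Type} [Finite I] [Finite J] (σ : I ≃ J) {p : P.obj I},
    p ∈ carrier I → P.relabel σ p ∈ carrier J
  comp_mem_left : ∀ {I : Type} [Finite I] {J : I → Type} [∀ i, Finite (J i)]
    {p : P.obj I} (q : ∀ i, P.obj (J i)), p ∈ carrier I → P.comp p q ∈ carrier (Σ i, J i)
  comp_mem_right : ∀ {I : Type} [Finite I] {J : I → Type} [∀ i, Finite (J i)]
    (p : P.obj I) (q : ∀ i, P.obj (J i)) (i : I),
    q i ∈ carrier (J i) → P.comp p q ∈ carrier (Σ i, J i)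

/-- The operadic ideal generated by a set of operations with inputs labelled by `A`: the
intersection of all ideals that contain it. -/
def Ideal.span (P : SymOperad.{u, v} K) {A : Type} [Finite A] (S : Set (P.obj A)) : P.Ideal where
  carrier I _ :=
    { carrier := {x | ∀ 𝔞 : P.Ideal, S ⊆ 𝔞.carrier A → x ∈ 𝔞.carrier I}
      add_mem' := fun hx hy 𝔞 h => (𝔞.carrier I).add_mem (hx 𝔞 h) (hy 𝔞 h)
      zero_mem' := fun 𝔞 _ => (𝔞.carrier I).zero_mem
      smul_mem' := fun c _ hx 𝔞 h => (𝔞.carrier I).smul_mem c (hx 𝔞 h) }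
  relabel_mem σ _ hp := fun 𝔞 h => 𝔞.relabel_mem σ (hp 𝔞 h)
  comp_mem_left q hp := fun 𝔞 h => 𝔞.comp_mem_left q (hp 𝔞 h)
  comp_mem_right p q i hq := fun 𝔞 h => 𝔞.comp_mem_right p q i (hq 𝔞 h)

theorem Ideal.comp_sub_mem {P : SymOperad.{u, v} K} (𝔞 : P.Ideal) {I : Type} [Finite I]
    {J : I → Type} [∀ i, Finite (J i)] {p p' : P.obj I} {q q' : ∀ i, P.obj (J i)}
    (hp : p - p' ∈ 𝔞.carrier I) (hq : ∀ i, q i - q' i ∈ 𝔞.carrier (J i)) :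
    P.comp p q - P.comp p' q' ∈ 𝔞.carrier (Σ i, J i) := by
  classical
  have := Fintype.ofFinite I
  have key : ∀ s : Finset I, P.comp p' (s.piecewise q q') - P.comp p' q' ∈
      𝔞.carrier (Σ i, J i) := by
    intro s
    induction s using Finset.induction_on with
    | empty => simp
    | insert a s ha ih =>
      have h1 : P.comp p' ((insert a s).piecewise q q') - P.comp p' (s.piecewise q q') =
          P.comp p' (Function.update (s.piecewise q q') a (q a - q' a)) := by
        rw [MultilinearMap.map_update_sub, Finset.piecewise_insert]
        congr 2
        rw [← Finset.piecewise_eq_of_notMem s q q' ha, Function.update_eq_self]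
      have h2 : P.comp p' ((insert a s).piecewise q q') - P.comp p' (s.piecewise q q') ∈
          𝔞.carrier (Σ i, J i) := by
        rw [h1]
        exact 𝔞.comp_mem_right _ _ a (by simpa using hq a)
      simpa using (𝔞.carrier _).add_mem h2 ih
  have h3 := key Finset.univ
  rw [Finset.piecewise_univ] at h3
  have h4 : P.comp p q - P.comp p' q ∈ 𝔞.carrier (Σ i, J i) := by
    have := 𝔞.comp_mem_left q hp
    simpa using this
  simpa using (𝔞.carrier _).add_mem h4 h3

/-- Composition in the quotient by an ideal. -/
def Ideal.quotComp {P : SymOperad.{u, v} K} (𝔞 : P.Ideal) {I : Type} [Finite I]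
    {J : I → Type} [∀ i, Finite (J i)] (p : P.obj I ⧸ 𝔞.carrier I)
    (q : ∀ i, P.obj (J i) ⧸ 𝔞.carrier (J i)) :
    P.obj (Σ i, J i) ⧸ 𝔞.carrier (Σ i, J i) :=
  Submodule.Quotient.mk (P.comp (Quotient.out p) (fun i => Quotient.out (q i)))

theorem Ideal.quotComp_mk {P : SymOperad.{u, v} K} (𝔞 : P.Ideal) {I : Type} [Finite I]
    {J : I → Type} [∀ i, Finite (J i)] (p : P.obj I) (q : ∀ i, P.obj (J i)) :
    𝔞.quotComp (Submodule.Quotient.mk p) (fun i => Submodule.Quotient.mk (q i)) =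
      Submodule.Quotient.mk (P.comp p q) := by
  have hout : ∀ {L : Type} [Finite L] (x : P.obj L),
      Quotient.out (Submodule.Quotient.mk x : P.obj L ⧸ 𝔞.carrier L) - x ∈ 𝔞.carrier L := by
    intro L _ x
    rw [← Submodule.Quotient.eq]
    exact Quotient.out_eq _
  unfold Ideal.quotComp
  rw [Submodule.Quotient.eq]
  exact 𝔞.comp_sub_mem (hout p) (fun i => hout (q i))

theorem Ideal.exists_rep {P : SymOperad.{u, v} K} (𝔞 : P.Ideal) {I : Type}
    {J : I → Type} [∀ i, Finite (J i)] (q : ∀ i, P.obj (J i) ⧸ 𝔞.carrier (J i)) :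
    ∃ q' : ∀ i, P.obj (J i), q = fun i => Submodule.Quotient.mk (q' i) :=
  ⟨fun i => Quotient.out (q i), funext fun i => (Quotient.out_eq (q i)).symm⟩

theorem Ideal.update_mk {P : SymOperad.{u, v} K} (𝔞 : P.Ideal) {I : Type} [DecidableEq I]
    {J : I → Type} [∀ i, Finite (J i)] (q : ∀ i, P.obj (J i)) (a : I) (x : P.obj (J a)) :
    Function.update (fun i => (Submodule.Quotient.mk (q i) : P.obj (J i) ⧸ 𝔞.carrier (J i))) a
        (Submodule.Quotient.mk x) =
      fun i => Submodule.Quotient.mk (Function.update q a x i) := by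
  funext i
  by_cases h : i = a
  · subst h; simp
  · simp [h]

/-- Composition in the quotient by an ideal, as a multilinear map. -/
def Ideal.quotCompLin {P : SymOperad.{u, v} K} (𝔞 : P.Ideal) {I : Type} [Finite I]
    {J : I → Type} [∀ i, Finite (J i)] :
    (P.obj I ⧸ 𝔞.carrier I) →ₗ[K]
      MultilinearMap K (fun i => P.obj (J i) ⧸ 𝔞.carrier (J i))
        (P.obj (Σ i, J i) ⧸ 𝔞.carrier (Σ i, J i)) where
  toFun p :=
    { toFun := fun q => 𝔞.quotComp p q
      map_update_add' := by
        intro _ q a x y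
        obtain ⟨p, rfl⟩ := Submodule.Quotient.mk_surjective _ p
        obtain ⟨q, rfl⟩ := 𝔞.exists_rep q
        obtain ⟨x, rfl⟩ := Submodule.Quotient.mk_surjective _ x
        obtain ⟨y, rfl⟩ := Submodule.Quotient.mk_surjective _ y
        have h := 𝔞.update_mk q a (x + y)
        rw [Submodule.Quotient.mk_add] at h
        rw [h, 𝔞.update_mk, 𝔞.update_mk, 𝔞.quotComp_mk, 𝔞.quotComp_mk, 𝔞.quotComp_mk,
          ← Submodule.Quotient.mk_add]
        exact congrArg _ ((P.comp p).map_update_add q a x y)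
      map_update_smul' := by
        intro _ q a c x
        obtain ⟨p, rfl⟩ := Submodule.Quotient.mk_surjective _ p
        obtain ⟨q, rfl⟩ := 𝔞.exists_rep q
        obtain ⟨x, rfl⟩ := Submodule.Quotient.mk_surjective _ x
        have h := 𝔞.update_mk q a (c • x)
        rw [Submodule.Quotient.mk_smul] at h
        rw [h, 𝔞.update_mk, 𝔞.quotComp_mk, 𝔞.quotComp_mk, ← Submodule.Quotient.mk_smul]
        exact congrArg _ ((P.comp p).map_update_smul q a c x) }
  map_add' p p' := by
    ext q
    obtain ⟨p, rfl⟩ := Submodule.Quotient.mk_surjective _ p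
    obtain ⟨p', rfl⟩ := Submodule.Quotient.mk_surjective _ p'
    obtain ⟨q, rfl⟩ := 𝔞.exists_rep q
    refine (𝔞.quotComp_mk (p + p') q).trans ?_
    rw [map_add]
    exact (congrArg₂ (· + ·) (𝔞.quotComp_mk p q) (𝔞.quotComp_mk p' q)).symm
  map_smul' c p := by
    ext q
    obtain ⟨p, rfl⟩ := Submodule.Quotient.mk_surjective _ p
    obtain ⟨q, rfl⟩ := 𝔞.exists_rep q
    refine (𝔞.quotComp_mk (c • p) q).trans ?_
    rw [map_smul]
    exact (congrArg (c • ·) (𝔞.quotComp_mk p q)).symm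

/-- Relabelling in the quotient by an ideal. -/
def Ideal.quotRelabel {P : SymOperad.{u, v} K} (𝔞 : P.Ideal) {I J : Type} [Finite I] [Finite J]
    (σ : I ≃ J) : (P.obj I ⧸ 𝔞.carrier I) →ₗ[K] (P.obj J ⧸ 𝔞.carrier J) :=
  (𝔞.carrier I).mapQ (𝔞.carrier J) (P.relabel σ) (fun _ hp => 𝔞.relabel_mem σ hp)

theorem Ideal.quotRelabel_mk {P : SymOperad.{u, v} K} (𝔞 : P.Ideal) {I J : Type} [Finite I]
    [Finite J] (σ : I ≃ J) (p : P.obj I) :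
    𝔞.quotRelabel σ (Submodule.Quotient.mk p) = Submodule.Quotient.mk (P.relabel σ p) := rfl

theorem Ideal.quotCompLin_mk {P : SymOperad.{u, v} K} (𝔞 : P.Ideal) {I : Type} [Finite I]
    {J : I → Type} [∀ i, Finite (J i)] (p : P.obj I) (q : ∀ i, P.obj (J i)) :
    𝔞.quotCompLin (Submodule.Quotient.mk p) (fun i => Submodule.Quotient.mk (q i)) =
      Submodule.Quotient.mk (P.comp p q) := 𝔞.quotComp_mk p q

/-- The quotient of an operad by an operadic ideal. -/
def quotient (P : SymOperad.{u, v} K) (𝔞 : P.Ideal) : SymOperad.{u, v} K where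
  obj I _ := P.obj I ⧸ 𝔞.carrier I
  relabel σ := 𝔞.quotRelabel σ
  one := Submodule.Quotient.mk P.one
  comp := 𝔞.quotCompLin
  relabel_refl p := by
    obtain ⟨p, rfl⟩ := Submodule.Quotient.mk_surjective _ p
    rw [𝔞.quotRelabel_mk, P.relabel_refl]
  relabel_trans σ τ p := by
    obtain ⟨p, rfl⟩ := Submodule.Quotient.mk_surjective _ p
    simp only [𝔞.quotRelabel_mk, P.relabel_trans]
  comp_relabel_left σ p q := by
    obtain ⟨p, rfl⟩ := Submodule.Quotient.mk_surjective _ p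
    obtain ⟨q, rfl⟩ := 𝔞.exists_rep q
    rw [𝔞.quotRelabel_mk, 𝔞.quotCompLin_mk, P.comp_relabel_left,
      𝔞.quotCompLin_mk p (fun i => q (σ i)), 𝔞.quotRelabel_mk]
  comp_relabel_right τ p q := by
    obtain ⟨p, rfl⟩ := Submodule.Quotient.mk_surjective _ p
    obtain ⟨q, rfl⟩ := 𝔞.exists_rep q
    simp only [𝔞.quotRelabel_mk]
    rw [𝔞.quotCompLin_mk p q, 𝔞.quotCompLin_mk p (fun i => P.relabel (τ i) (q i)),
      P.comp_relabel_right, 𝔞.quotRelabel_mk]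
  one_comp q := by
    obtain ⟨q, rfl⟩ := Submodule.Quotient.mk_surjective _ q
    rw [𝔞.quotCompLin_mk P.one (fun _ => q), 𝔞.quotRelabel_mk, P.one_comp]
  comp_one p := by
    obtain ⟨p, rfl⟩ := Submodule.Quotient.mk_surjective _ p
    rw [𝔞.quotCompLin_mk p (fun _ => P.one), 𝔞.quotRelabel_mk, P.comp_one]
  comp_assoc {I} _ {J} _ {L} _ p q r := by
    obtain ⟨p, rfl⟩ := Submodule.Quotient.mk_surjective _ p
    obtain ⟨q, rfl⟩ := 𝔞.exists_rep q
    obtain ⟨r, rfl⟩ : ∃ r' : ∀ i j, P.obj (L i j),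
        r = fun i j => Submodule.Quotient.mk (r' i j) :=
      ⟨fun i j => Quotient.out (r i j),
        funext fun i => funext fun j => (Quotient.out_eq (r i j)).symm⟩
    rw [𝔞.quotCompLin_mk p q,
      𝔞.quotCompLin_mk (J := fun x : Σ i, J i => L x.1 x.2) (P.comp p q) (fun x => r x.1 x.2),
      𝔞.quotRelabel_mk, P.comp_assoc]
    simp only [𝔞.quotCompLin_mk]

/-- The projection onto the quotient operad, in arity `I`. -/
def quotientMk (P : SymOperad.{u, v} K) (𝔞 : P.Ideal) (I : Type) [Finite I] :
    P.obj I →ₗ[K] (P.quotient 𝔞).obj I :=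
  (𝔞.carrier I).mkQ

/-! ### Compositions of two binary operations -/

/-- The family of sets `A, B` indexed by `Fin 2`. -/
def pairArity (A B : Type) : Fin 2 → Type
  | 0 => A
  | 1 => B

instance pairArityFinite (A B : Type) [Finite A] [Finite B] : ∀ i, Finite (pairArity A B i)
  | 0 => inferInstanceAs (Finite A)
  | 1 => inferInstanceAs (Finite B)

def pairEquiv (A B : Type) : (Σ i, pairArity A B i) ≃ A ⊕ B where
  toFun
    | ⟨0, a⟩ => Sum.inl a
    | ⟨1, b⟩ => Sum.inr b
  invFun
    | Sum.inl a => ⟨0, a⟩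
    | Sum.inr b => ⟨1, b⟩
  left_inv := by rintro ⟨i, x⟩; fin_cases i <;> rfl
  right_inv := by rintro (x | x) <;> rfl

def pairFam (P : SymOperad.{u, v} K) {A B : Type} [Finite A] [Finite B]
    (a : P.obj A) (b : P.obj B) : ∀ i, P.obj (pairArity A B i)
  | 0 => a
  | 1 => b

/-- The operation `p(a(…), b(…))`, for a binary operation `p`. -/
def graft (P : SymOperad.{u, v} K) {A B : Type} [Finite A] [Finite B]
    (p : P.obj (Fin 2)) (a : P.obj A) (b : P.obj B) : P.obj (A ⊕ B) :=
  P.relabel (pairEquiv A B) (P.comp p (P.pairFam a b))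

/-- The ternary operation `p(q(x₀, x₁), x₂)`. -/
def leftComb (P : SymOperad.{u, v} K) (p q : P.obj (Fin 2)) : P.obj (Fin 3) :=
  P.relabel
    (((Equiv.refl (Fin 2)).sumCongr (Equiv.ofUnique Unit (Fin 1))).trans finSumFinEquiv)
    (P.graft p q P.one)

/-- The ternary operation `p(x₀, q(x₁, x₂))`. -/
def rightComb (P : SymOperad.{u, v} K) (p q : P.obj (Fin 2)) : P.obj (Fin 3) :=
  P.relabel
    (((Equiv.ofUnique Unit (Fin 1)).sumCongr (Equiv.refl (Fin 2))).trans finSumFinEquiv)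
    (P.graft p P.one q)

theorem update_pairFam (P : SymOperad.{u, v} K) {A B : Type} [Finite A] [Finite B]
    (a' : P.obj A) (b : P.obj B) (a : P.obj (pairArity A B 0)) :
    Function.update (P.pairFam a' b) 0 a = P.pairFam (A := A) a b := by
  funext i
  fin_cases i <;> rfl

theorem leftComb_add_right (P : SymOperad.{u, v} K) (p q q' : P.obj (Fin 2)) :
    P.leftComb p (q + q') = P.leftComb p q + P.leftComb p q' := by
  have h := (P.comp p).map_update_add (P.pairFam (0 : P.obj (Fin 2)) P.one) 0
    (show P.obj (pairArity (Fin 2) Unit 0) from q) (show P.obj (pairArity (Fin 2) Unit 0) from q')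
  rw [P.update_pairFam, P.update_pairFam, P.update_pairFam] at h
  unfold leftComb graft
  refine (congrArg (fun x => P.relabel _ (P.relabel _ x)) h).trans ?_
  simp only [map_add]

theorem leftComb_smul_right (P : SymOperad.{u, v} K) (c : K) (p q : P.obj (Fin 2)) :
    P.leftComb p (c • q) = c • P.leftComb p q := by
  have h := (P.comp p).map_update_smul (P.pairFam (0 : P.obj (Fin 2)) P.one) 0 c
    (show P.obj (pairArity (Fin 2) Unit 0) from q)
  rw [P.update_pairFam, P.update_pairFam] at h
  unfold leftComb graft
  refine (congrArg (fun x => P.relabel _ (P.relabel _ x)) h).trans ?_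
  simp only [map_smul]

/-- `leftComb` as a bilinear map. -/
def leftCombLin (P : SymOperad.{u, v} K) :
    P.obj (Fin 2) →ₗ[K] P.obj (Fin 2) →ₗ[K] P.obj (Fin 3) :=
  LinearMap.mk₂ K P.leftComb
    (fun p p' q => by simp [leftComb, graft])
    (fun c p q => by simp [leftComb, graft])
    (fun p q q' => P.leftComb_add_right p q q')
    (fun c p q => P.leftComb_smul_right c p q)

end SymOperad

/-! ### The free operad on binary generators -/

section Free

variable {K : Type u} [Field K] {E : Type v} [AddCommGroup E] [Module K E]

/-- Formal operadic expressions in generators `e ∈ E` of arity two. -/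
inductive FreePre (K : Type u) (E : Type v) : (I : Type) → [Finite I] → Type (max 1 u v)
  | gen (e : E) : FreePre K E (Fin 2)
  | one : FreePre K E Unit
  | relabel {I J : Type} [Finite I] [Finite J] (σ : I ≃ J) (p : FreePre K E I) : FreePre K E J
  | comp {I : Type} [Finite I] {J : I → Type} [∀ i, Finite (J i)] (p : FreePre K E I)
      (q : ∀ i, FreePre K E (J i)) : FreePre K E (Σ i, J i)
  | zero (I : Type) [Finite I] : FreePre K E I
  | add {I : Type} [Finite I] (p q : FreePre K E I) : FreePre K E I
  | smul {I : Type} [Finite I] (c : K) (p : FreePre K E I) : FreePre K E I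

/-- The congruence on expressions generated by the axioms of a vector space, the axioms of an
operad, and the requirement that `E → F(E)(2)` is linear and `S₂`-equivariant. -/
inductive FreeRel (ρ : Representation K (Equiv.Perm (Fin 2)) E) :
    ∀ {I : Type} [Finite I], FreePre K E I → FreePre K E I → Prop
  -- equivalence relation
  | refl {I : Type} [Finite I] (p : FreePre K E I) : FreeRel ρ p p
  | symm {I : Type} [Finite I] {p q : FreePre K E I} : FreeRel ρ p q → FreeRel ρ q p
  | trans {I : Type} [Finite I] {p q r : FreePre K E I} :
      FreeRel ρ p q → FreeRel ρ q r → FreeRel ρ p r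
  -- compatibility with the operations
  | relabel_congr {I J : Type} [Finite I] [Finite J] (σ : I ≃ J) {p q : FreePre K E I} :
      FreeRel ρ p q → FreeRel ρ (p.relabel σ) (q.relabel σ)
  | comp_congr {I : Type} [Finite I] {J : I → Type} [∀ i, Finite (J i)] {p p' : FreePre K E I}
      {q q' : ∀ i, FreePre K E (J i)} :
      FreeRel ρ p p' → (∀ i, FreeRel ρ (q i) (q' i)) → FreeRel ρ (p.comp q) (p'.comp q')
  | add_congr {I : Type} [Finite I] {p p' q q' : FreePre K E I} :
      FreeRel ρ p p' → FreeRel ρ q q' → FreeRel ρ (p.add q) (p'.add q')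
  | smul_congr {I : Type} [Finite I] (c : K) {p p' : FreePre K E I} :
      FreeRel ρ p p' → FreeRel ρ (p.smul c) (p'.smul c)
  -- vector space axioms
  | add_assoc {I : Type} [Finite I] (p q r : FreePre K E I) :
      FreeRel ρ ((p.add q).add r) (p.add (q.add r))
  | add_comm {I : Type} [Finite I] (p q : FreePre K E I) : FreeRel ρ (p.add q) (q.add p)
  | zero_add {I : Type} [Finite I] (p : FreePre K E I) : FreeRel ρ ((FreePre.zero I).add p) p
  | one_smul {I : Type} [Finite I] (p : FreePre K E I) : FreeRel ρ (p.smul 1) p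
  | mul_smul {I : Type} [Finite I] (a b : K) (p : FreePre K E I) :
      FreeRel ρ (p.smul (a * b)) ((p.smul b).smul a)
  | smul_add {I : Type} [Finite I] (a : K) (p q : FreePre K E I) :
      FreeRel ρ ((p.add q).smul a) ((p.smul a).add (q.smul a))
  | add_smul {I : Type} [Finite I] (a b : K) (p : FreePre K E I) :
      FreeRel ρ (p.smul (a + b)) ((p.smul a).add (p.smul b))
  | zero_smul {I : Type} [Finite I] (p : FreePre K E I) :
      FreeRel ρ (p.smul 0) (FreePre.zero I)
  -- linearity of relabelling and multilinearity of composition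
  | relabel_add {I J : Type} [Finite I] [Finite J] (σ : I ≃ J) (p q : FreePre K E I) :
      FreeRel ρ ((p.add q).relabel σ) ((p.relabel σ).add (q.relabel σ))
  | relabel_smul {I J : Type} [Finite I] [Finite J] (σ : I ≃ J) (c : K) (p : FreePre K E I) :
      FreeRel ρ ((p.smul c).relabel σ) ((p.relabel σ).smul c)
  | comp_add_left {I : Type} [Finite I] {J : I → Type} [∀ i, Finite (J i)]
      (p p' : FreePre K E I) (q : ∀ i, FreePre K E (J i)) :
      FreeRel ρ ((p.add p').comp q) ((p.comp q).add (p'.comp q))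
  | comp_smul_left {I : Type} [Finite I] {J : I → Type} [∀ i, Finite (J i)] (c : K)
      (p : FreePre K E I) (q : ∀ i, FreePre K E (J i)) :
      FreeRel ρ ((p.smul c).comp q) ((p.comp q).smul c)
  | comp_add_right {I : Type} [Finite I] [DecidableEq I] {J : I → Type} [∀ i, Finite (J i)]
      (p : FreePre K E I) (q : ∀ i, FreePre K E (J i)) (i : I) (x y : FreePre K E (J i)) :
      FreeRel ρ (p.comp (Function.update q i (x.add y)))
        ((p.comp (Function.update q i x)).add (p.comp (Function.update q i y)))
  | comp_smul_right {I : Type} [Finite I] [DecidableEq I] {J : I → Type} [∀ i, Finite (J i)]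
      (p : FreePre K E I) (q : ∀ i, FreePre K E (J i)) (i : I) (c : K) (x : FreePre K E (J i)) :
      FreeRel ρ (p.comp (Function.update q i (x.smul c)))
        ((p.comp (Function.update q i x)).smul c)
  -- operad axioms
  | relabel_refl {I : Type} [Finite I] (p : FreePre K E I) :
      FreeRel ρ (p.relabel (Equiv.refl I)) p
  | relabel_trans {I J L : Type} [Finite I] [Finite J] [Finite L] (σ : I ≃ J) (τ : J ≃ L)
      (p : FreePre K E I) : FreeRel ρ (p.relabel (σ.trans τ)) ((p.relabel σ).relabel τ)
  | comp_relabel_left {I I' : Type} [Finite I] [Finite I'] {J : I' → Type}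
      [∀ i, Finite (J i)] (σ : I ≃ I') (p : FreePre K E I) (q : ∀ i, FreePre K E (J i)) :
      FreeRel ρ ((p.relabel σ).comp q)
        ((p.comp (fun i => q (σ i))).relabel (Equiv.sigmaCongrLeft (β := J) σ))
  | comp_relabel_right {I : Type} [Finite I] {J J' : I → Type} [∀ i, Finite (J i)]
      [∀ i, Finite (J' i)] (τ : ∀ i, J i ≃ J' i) (p : FreePre K E I)
      (q : ∀ i, FreePre K E (J i)) :
      FreeRel ρ (p.comp (fun i => (q i).relabel (τ i)))
        ((p.comp q).relabel (Equiv.sigmaCongrRight τ))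
  | one_comp {J : Type} [Finite J] (q : FreePre K E J) :
      FreeRel ρ ((FreePre.one.comp (fun _ : Unit => q)).relabel
        (Equiv.uniqueSigma (fun _ : Unit => J))) q
  | comp_one {I : Type} [Finite I] (p : FreePre K E I) :
      FreeRel ρ ((p.comp (fun _ : I => FreePre.one)).relabel
        (Equiv.sigmaUnique I (fun _ => Unit))) p
  | comp_assoc {I : Type} [Finite I] {J : I → Type} [∀ i, Finite (J i)]
      {L : ∀ i, J i → Type} [∀ i j, Finite (L i j)] (p : FreePre K E I)
      (q : ∀ i, FreePre K E (J i)) (r : ∀ i j, FreePre K E (L i j)) :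
      FreeRel ρ
        ((FreePre.comp (J := fun x : Σ i, J i => L x.1 x.2) (p.comp q)
          (fun x => r x.1 x.2)).relabel (Equiv.sigmaAssoc L))
        (p.comp (fun i => (q i).comp (r i)))
  -- linearity and equivariance of the generators
  | gen_add (e e' : E) : FreeRel ρ (FreePre.gen (e + e')) ((FreePre.gen e).add (FreePre.gen e'))
  | gen_smul (c : K) (e : E) : FreeRel ρ (FreePre.gen (c • e)) ((FreePre.gen e).smul c)
  | gen_perm (σ : Equiv.Perm (Fin 2)) (e : E) :
      FreeRel ρ (FreePre.gen (ρ σ e)) ((FreePre.gen e).relabel σ)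

variable (ρ : Representation K (Equiv.Perm (Fin 2)) E)

def freeSetoid (I : Type) [Finite I] : Setoid (FreePre K E I) :=
  ⟨FreeRel ρ, FreeRel.refl, FreeRel.symm, FreeRel.trans⟩

/-- The operations of the free operad with inputs labelled by `I`. -/
def FreeObj (I : Type) [Finite I] : Type (max 1 u v) := Quotient (freeSetoid ρ I)

namespace FreeObj

def mk {I : Type} [Finite I] (p : FreePre K E I) : FreeObj ρ I := Quotient.mk (freeSetoid ρ I) p

variable {ρ} in
theorem mk_eq {I : Type} [Finite I] {p q : FreePre K E I} (h : FreeRel ρ p q) :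
    mk ρ p = mk ρ q := Quotient.sound (s := freeSetoid ρ I) h

variable {ρ} in
theorem mk_surj {I : Type} [Finite I] (x : FreeObj ρ I) : ∃ p, mk ρ p = x :=
  Quotient.exists_rep x

variable {ρ} in
/-- A chosen representing expression. -/
def rep {I : Type} [Finite I] (x : FreeObj ρ I) : FreePre K E I := Quotient.out x

theorem rep_rel {I : Type} [Finite I] (p : FreePre K E I) : FreeRel ρ (rep (mk ρ p)) p :=
  Quotient.exact (s := freeSetoid ρ I) (Quotient.out_eq _)

variable {ρ} in
theorem mk_rep {I : Type} [Finite I] (x : FreeObj ρ I) : mk ρ (rep x) = x := Quotient.out_eq x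

instance {I : Type} [Finite I] : Add (FreeObj ρ I) :=
  ⟨Quotient.map₂ FreePre.add (fun _ _ h _ _ h' => FreeRel.add_congr h h')⟩

instance {I : Type} [Finite I] : SMul K (FreeObj ρ I) :=
  ⟨fun c => Quotient.map (FreePre.smul c) (fun _ _ h => FreeRel.smul_congr c h)⟩

instance {I : Type} [Finite I] : Zero (FreeObj ρ I) := ⟨mk ρ (FreePre.zero I)⟩

instance {I : Type} [Finite I] : AddCommMonoid (FreeObj ρ I) where
  add_assoc x y z := by
    obtain ⟨x, rfl⟩ := mk_surj x
    obtain ⟨y, rfl⟩ := mk_surj y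
    obtain ⟨z, rfl⟩ := mk_surj z
    exact mk_eq (FreeRel.add_assoc x y z)
  add_comm x y := by
    obtain ⟨x, rfl⟩ := mk_surj x
    obtain ⟨y, rfl⟩ := mk_surj y
    exact mk_eq (FreeRel.add_comm x y)
  zero_add x := by
    obtain ⟨x, rfl⟩ := mk_surj x
    exact mk_eq (FreeRel.zero_add x)
  add_zero x := by
    obtain ⟨x, rfl⟩ := mk_surj x
    exact mk_eq ((FreeRel.add_comm _ _).trans (FreeRel.zero_add x))
  nsmul := nsmulRec

instance {I : Type} [Finite I] : Module K (FreeObj ρ I) where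
  one_smul x := by
    obtain ⟨x, rfl⟩ := mk_surj x
    exact mk_eq (FreeRel.one_smul x)
  mul_smul a b x := by
    obtain ⟨x, rfl⟩ := mk_surj x
    exact mk_eq (FreeRel.mul_smul a b x)
  smul_add a x y := by
    obtain ⟨x, rfl⟩ := mk_surj x
    obtain ⟨y, rfl⟩ := mk_surj y
    exact mk_eq (FreeRel.smul_add a x y)
  smul_zero a := by
    have h0 : FreeRel ρ (FreePre.zero I) ((FreePre.zero I).smul 0) :=
      (FreeRel.zero_smul _).symm
    have h1 : FreeRel ρ ((FreePre.zero I).smul a) ((FreePre.zero I).smul (a * 0)) :=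
      (FreeRel.smul_congr a h0).trans (FreeRel.mul_smul a 0 _).symm
    rw [mul_zero] at h1
    exact mk_eq (h1.trans (FreeRel.zero_smul _))
  add_smul a b x := by
    obtain ⟨x, rfl⟩ := mk_surj x
    exact mk_eq (FreeRel.add_smul a b x)
  zero_smul x := by
    obtain ⟨x, rfl⟩ := mk_surj x
    exact mk_eq (FreeRel.zero_smul x)

instance {I : Type} [Finite I] : AddCommGroup (FreeObj ρ I) :=
  Module.addCommMonoidToAddCommGroup K

def comp {I : Type} [Finite I] {J : I → Type} [∀ i, Finite (J i)] (p : FreeObj ρ I)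
    (q : ∀ i, FreeObj ρ (J i)) : FreeObj ρ (Σ i, J i) :=
  mk ρ ((rep p).comp (fun i => rep (q i)))

theorem comp_mk {I : Type} [Finite I] {J : I → Type} [∀ i, Finite (J i)] (p : FreePre K E I)
    (q : ∀ i, FreePre K E (J i)) :
    comp ρ (mk ρ p) (fun i => mk ρ (q i)) = mk ρ (p.comp q) :=
  mk_eq (FreeRel.comp_congr (rep_rel ρ p) (fun i => rep_rel ρ (q i)))

variable {ρ} in
theorem fam_surj {I : Type} {J : I → Type} [∀ i, Finite (J i)] (q : ∀ i, FreeObj ρ (J i)) :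
    ∃ q' : ∀ i, FreePre K E (J i), q = fun i => mk ρ (q' i) :=
  ⟨fun i => rep (q i), funext fun i => (mk_rep (q i)).symm⟩

theorem update_mk {I : Type} [DecidableEq I] {J : I → Type} [∀ i, Finite (J i)]
    (q : ∀ i, FreePre K E (J i)) (a : I) (x : FreePre K E (J a)) :
    Function.update (fun i => mk ρ (q i)) a (mk ρ x) =
      fun i => mk ρ (Function.update q a x i) := by
  funext i
  by_cases h : i = a
  · subst h; simp
  · simp [h]

/-- Composition as a multilinear map. -/
def compLin {I : Type} [Finite I] {J : I → Type} [∀ i, Finite (J i)] :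
    FreeObj ρ I →ₗ[K] MultilinearMap K (fun i => FreeObj ρ (J i)) (FreeObj ρ (Σ i, J i)) where
  toFun p :=
    { toFun := fun q => comp ρ p q
      map_update_add' := by
        intro _ q i x y
        obtain ⟨p, rfl⟩ := mk_surj p
        obtain ⟨q, rfl⟩ := fam_surj q
        obtain ⟨x, rfl⟩ := mk_surj x
        obtain ⟨y, rfl⟩ := mk_surj y
        rw [show mk ρ x + mk ρ y = mk ρ (x.add y) from rfl, update_mk, update_mk, update_mk,
          comp_mk, comp_mk, comp_mk]
        exact mk_eq (FreeRel.comp_add_right p q i x y)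
      map_update_smul' := by
        intro _ q i c x
        obtain ⟨p, rfl⟩ := mk_surj p
        obtain ⟨q, rfl⟩ := fam_surj q
        obtain ⟨x, rfl⟩ := mk_surj x
        rw [show c • mk ρ x = mk ρ (x.smul c) from rfl, update_mk, update_mk, comp_mk, comp_mk]
        exact mk_eq (FreeRel.comp_smul_right p q i c x) }
  map_add' p p' := by
    ext q
    obtain ⟨p, rfl⟩ := mk_surj p
    obtain ⟨p', rfl⟩ := mk_surj p'
    obtain ⟨q, rfl⟩ := fam_surj q
    refine (comp_mk ρ (p.add p') q).trans ?_
    refine (mk_eq (FreeRel.comp_add_left p p' q)).trans ?_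
    exact (congrArg₂ (· + ·) (comp_mk ρ p q) (comp_mk ρ p' q)).symm
  map_smul' c p := by
    ext q
    obtain ⟨p, rfl⟩ := mk_surj p
    obtain ⟨q, rfl⟩ := fam_surj q
    refine (comp_mk ρ (p.smul c) q).trans ?_
    refine (mk_eq (FreeRel.comp_smul_left c p q)).trans ?_
    exact (congrArg (c • ·) (comp_mk ρ p q)).symm

theorem compLin_mk {I : Type} [Finite I] {J : I → Type} [∀ i, Finite (J i)] (p : FreePre K E I)
    (q : ∀ i, FreePre K E (J i)) :
    compLin ρ (mk ρ p) (fun i => mk ρ (q i)) = mk ρ (p.comp q) := comp_mk ρ p q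

/-- Relabelling as a linear map. -/
def relabelLin {I J : Type} [Finite I] [Finite J] (σ : I ≃ J) : FreeObj ρ I →ₗ[K] FreeObj ρ J where
  toFun := Quotient.map (FreePre.relabel σ) (fun _ _ h => FreeRel.relabel_congr σ h)
  map_add' x y := by
    obtain ⟨x, rfl⟩ := mk_surj x
    obtain ⟨y, rfl⟩ := mk_surj y
    exact mk_eq (FreeRel.relabel_add σ x y)
  map_smul' c x := by
    obtain ⟨x, rfl⟩ := mk_surj x
    exact mk_eq (FreeRel.relabel_smul σ c x)

theorem relabelLin_mk {I J : Type} [Finite I] [Finite J] (σ : I ≃ J) (p : FreePre K E I) :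
    relabelLin ρ σ (mk ρ p) = mk ρ (p.relabel σ) := rfl

end FreeObj

/-- The free operad `F(E)` on the `S₂`-module `E`, placed in arity two. -/
def freeOperad : SymOperad.{u, max 1 u v} K where
  obj I _ := FreeObj ρ I
  relabel σ := FreeObj.relabelLin ρ σ
  one := FreeObj.mk ρ FreePre.one
  comp := FreeObj.compLin ρ
  relabel_refl p := by
    obtain ⟨p, rfl⟩ := FreeObj.mk_surj p
    exact FreeObj.mk_eq (FreeRel.relabel_refl p)
  relabel_trans σ τ p := by
    obtain ⟨p, rfl⟩ := FreeObj.mk_surj p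
    exact FreeObj.mk_eq (FreeRel.relabel_trans σ τ p)
  comp_relabel_left σ p q := by
    obtain ⟨p, rfl⟩ := FreeObj.mk_surj p
    obtain ⟨q, rfl⟩ := FreeObj.fam_surj q
    rw [FreeObj.relabelLin_mk, FreeObj.compLin_mk, FreeObj.compLin_mk ρ p (fun i => q (σ i)),
      FreeObj.relabelLin_mk]
    exact FreeObj.mk_eq (FreeRel.comp_relabel_left σ p q)
  comp_relabel_right τ p q := by
    obtain ⟨p, rfl⟩ := FreeObj.mk_surj p
    obtain ⟨q, rfl⟩ := FreeObj.fam_surj q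
    simp only [FreeObj.relabelLin_mk]
    rw [FreeObj.compLin_mk ρ p q, FreeObj.compLin_mk ρ p (fun i => (q i).relabel (τ i)),
      FreeObj.relabelLin_mk]
    exact FreeObj.mk_eq (FreeRel.comp_relabel_right τ p q)
  one_comp q := by
    obtain ⟨q, rfl⟩ := FreeObj.mk_surj q
    rw [FreeObj.compLin_mk ρ FreePre.one (fun _ : Unit => q), FreeObj.relabelLin_mk]
    exact FreeObj.mk_eq (FreeRel.one_comp q)
  comp_one p := by
    obtain ⟨p, rfl⟩ := FreeObj.mk_surj p
    rw [FreeObj.compLin_mk ρ p (fun _ => FreePre.one), FreeObj.relabelLin_mk]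
    exact FreeObj.mk_eq (FreeRel.comp_one p)
  comp_assoc {I} _ {J} _ {L} _ p q r := by
    obtain ⟨p, rfl⟩ := FreeObj.mk_surj p
    obtain ⟨q, rfl⟩ := FreeObj.fam_surj q
    obtain ⟨r, rfl⟩ : ∃ r' : ∀ i j, FreePre K E (L i j),
        r = fun i j => FreeObj.mk ρ (r' i j) :=
      ⟨fun i j => FreeObj.rep (r i j),
        funext fun i => funext fun j => (FreeObj.mk_rep (r i j)).symm⟩
    rw [FreeObj.compLin_mk ρ p q,
      FreeObj.compLin_mk ρ (J := fun x : Σ i, J i => L x.1 x.2) (p.comp q) (fun x => r x.1 x.2),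
      FreeObj.relabelLin_mk]
    simp only [FreeObj.compLin_mk]
    exact FreeObj.mk_eq (FreeRel.comp_assoc p q r)

/-- The canonical map `E → F(E)(2)`. -/
def freeGen : E →ₗ[K] (freeOperad ρ).obj (Fin 2) where
  toFun e := FreeObj.mk ρ (FreePre.gen e)
  map_add' e e' := FreeObj.mk_eq (FreeRel.gen_add e e')
  map_smul' c e := FreeObj.mk_eq (FreeRel.gen_smul c e)

/-! ### Binary quadratic operads and Koszul duality -/

/-- The sub-`S₃`-module of `F(E)(3)` generated by a set. -/
def permSpan (S : Set ((freeOperad ρ).obj (Fin 3))) : Submodule K ((freeOperad ρ).obj (Fin 3)) :=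
  Submodule.span K
    {y | ∃ (σ : Equiv.Perm (Fin 3)) (x : (freeOperad ρ).obj (Fin 3)),
      x ∈ S ∧ y = (freeOperad ρ).relabel σ x}

/-- The binary quadratic operad `P(E, R) = F(E)/(R)`. -/
def quadraticOperad (R : Submodule K ((freeOperad ρ).obj (Fin 3))) :
    SymOperad.{u, max 1 u v} K :=
  (freeOperad ρ).quotient
    (SymOperad.Ideal.span (freeOperad ρ) (R : Set ((freeOperad ρ).obj (Fin 3))))

/-- The class of a generator in `P(E, R)(2)`. -/
def quadraticGen (R : Submodule K ((freeOperad ρ).obj (Fin 3))) :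
    E →ₗ[K] (quadraticOperad ρ R).obj (Fin 2) :=
  (freeOperad ρ).quotientMk _ (Fin 2) ∘ₗ freeGen ρ

/-- The three-cycle `(0 1 2)`. -/
def cyc : Equiv.Perm (Fin 3) := finRotate 3

/-- The identification of three copies of `E ⊗ E` with `F(E)(3)`: an element `μ ⊗ ν` of the copies
`0`, `1`, `2` is sent to `μ(ν(x₀, x₁), x₂)`, `μ(ν(x₁, x₂), x₀)`, `μ(ν(x₂, x₀), x₁)`. -/
def cubicMap : (Fin 3 → E ⊗[K] E) →ₗ[K] (freeOperad ρ).obj (Fin 3) :=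
  LinearMap.lsum K (fun _ : Fin 3 => E ⊗[K] E) K fun t =>
    (freeOperad ρ).relabel (cyc ^ (t : ℕ)) ∘ₗ
      TensorProduct.lift ((freeOperad ρ).leftCombLin.compl₁₂ (freeGen ρ) (freeGen ρ))

/-- The dual representation twisted by the sign, `E^∨ = E^* ⊗ sgn`. -/
def signDual : Representation K (Equiv.Perm (Fin 2)) (Module.Dual K E) where
  toFun σ := ((Equiv.Perm.sign σ : ℤˣ) : ℤ) • ρ.dual σ
  map_one' := by rw [map_one, map_one, Units.val_one, one_smul]
  map_mul' σ τ := by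
    rw [map_mul, map_mul, Units.val_mul, smul_mul_smul_comm]

variable (K E) in
/-- The pairing of three copies of `E^* ⊗ E^*` with three copies of `E ⊗ E`: the copies with
different indices are orthogonal, and `⟨α ⊗ β, μ ⊗ ν⟩ = α(μ) β(ν)` for equal indices. -/
def cubicPairing (f : Fin 3 → Module.Dual K E ⊗[K] Module.Dual K E) (g : Fin 3 → E ⊗[K] E) : K :=
  ∑ t, TensorProduct.dualDistrib K E E (f t) (g t)

/-- The orthogonal complement `R^⊥ ⊆ F(E^∨)(3)` of `R ⊆ F(E)(3)`, with respect to the pairing above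
and the identifications `cubicMap` of `F(E^∨)(3)` and `F(E)(3)` with three copies of the tensor
square of the generators. -/
def orthComplement (R : Submodule K ((freeOperad ρ).obj (Fin 3))) :
    Submodule K ((freeOperad (signDual ρ)).obj (Fin 3)) :=
  Submodule.map (cubicMap (signDual ρ))
    { carrier := {f | ∀ g, cubicMap ρ g ∈ R → cubicPairing K E f g = 0}
      add_mem' := by
        intro f f' hf hf' g hg
        have h1 := hf g hg
        have h2 := hf' g hg
        simp only [cubicPairing] at h1 h2 ⊢
        simp only [Pi.add_apply, map_add, LinearMap.add_apply, Finset.sum_add_distrib, h1, h2,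
          add_zero]
      zero_mem' := by
        intro g _
        simp [cubicPairing]
      smul_mem' := by
        intro c f hf g hg
        have h1 := hf g hg
        simp only [cubicPairing] at h1 ⊢
        simp only [Pi.smul_apply, map_smul, LinearMap.smul_apply, ← Finset.smul_sum, h1,
          smul_zero] }

/-- The Koszul dual operad `P(E, R)^! = P(E^∨, R^⊥)` of the binary quadratic operad `P(E, R)`, for a
finite-dimensional `S₂`-module `E` and a sub-`S₃`-module `R` of `F(E)(3)`. -/
def koszulDual (R : Submodule K ((freeOperad ρ).obj (Fin 3))) : SymOperad.{u, max 1 u v} K :=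
  quadraticOperad (signDual ρ) (orthComplement ρ R)

end Free

/-! ### Symmetric Leibniz algebras and com.-admissible algebras -/

section Examples

variable (K : Type u) [Field K]

/-- The `S₂`-module spanned by one binary operation without symmetry: the regular representation. -/
abbrev OneOp : Type u := MonoidAlgebra K (Equiv.Perm (Fin 2))

abbrev oneOp : Representation K (Equiv.Perm (Fin 2)) (OneOp K) :=
  Representation.leftRegular K (Equiv.Perm (Fin 2))

/-- The binary operation `a · b`. -/
def mulGen : OneOp K := MonoidAlgebra.single 1 1

/-- The opposite operation `b · a`. -/
def mulOpGen : OneOp K := oneOp K (Equiv.swap 0 1) (mulGen K)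

/-- The bracket `[a, b] = a · b - b · a`. -/
def lieGen : OneOp K := mulGen K - mulOpGen K

/-- The symmetrized product `a ◇ b = a · b + b · a`. -/
def symGen : OneOp K := mulGen K + mulOpGen K

/-- The first vector of the basis of `E^*` dual to the basis `[,], ◇` of `E`. -/
def lieGenDual : Module.Dual K (OneOp K) where
  toFun x := (x.coeff 1 - x.coeff (Equiv.swap 0 1)) / 2
  map_add' x y := by simp; ring
  map_smul' c x := by simp; ring

/-- The second vector of the basis of `E^*` dual to the basis `[,], ◇` of `E`. -/
def symGenDual : Module.Dual K (OneOp K) where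
  toFun x := (x.coeff 1 + x.coeff (Equiv.swap 0 1)) / 2
  map_add' x y := by simp; ring
  map_smul' c x := by simp; ring

variable {K} in
theorem dual_basis [CharZero K] :
    lieGenDual K (lieGen K) = 1 ∧ lieGenDual K (symGen K) = 0 ∧
      symGenDual K (lieGen K) = 0 ∧ symGenDual K (symGen K) = 1 := by
  have h : (Equiv.swap (0 : Fin 2) 1) ≠ 1 := by decide
  simp [lieGenDual, symGenDual, lieGen, symGen, mulOpGen, mulGen,
    Representation.ofMulAction_single, h, h.symm]

/-- The left Leibniz relation `a · (b · c) - (a · b) · c - b · (a · c)`. -/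
def leftLeibniz : (freeOperad (oneOp K)).obj (Fin 3) :=
  let F := freeOperad (oneOp K)
  let m := freeGen (oneOp K) (mulGen K)
  F.rightComb m m - F.leftComb m m - F.relabel (Equiv.swap 0 1) (F.rightComb m m)

/-- The right Leibniz relation `(a · b) · c - a · (b · c) - (a · c) · b`. -/
def rightLeibniz : (freeOperad (oneOp K)).obj (Fin 3) :=
  let F := freeOperad (oneOp K)
  let m := freeGen (oneOp K) (mulGen K)
  F.leftComb m m - F.rightComb m m - F.relabel (Equiv.swap 1 2) (F.leftComb m m)

/-- The relations of symmetric Leibniz algebras. -/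
def sLeibRel : Submodule K ((freeOperad (oneOp K)).obj (Fin 3)) :=
  permSpan (oneOp K) {leftLeibniz K, rightLeibniz K}

/-- The operad of symmetric Leibniz algebras. -/
def sLeib : SymOperad K := quadraticOperad (oneOp K) (sLeibRel K)

/-- The associator `(x₀ s x₁) s x₂ - x₀ s (x₁ s x₂)` of a binary operation `s` of an operad. -/
def SymOperad.associator {K : Type u} [Field K] (P : SymOperad.{u, v} K) (s : P.obj (Fin 2)) :
    P.obj (Fin 3) :=
  P.leftComb s s - P.rightComb s s

/-- The relations of com.-admissible algebras: the associativity of `◇`. -/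
def comAdmRel : Submodule K ((freeOperad (oneOp K)).obj (Fin 3)) :=
  permSpan (oneOp K) {(freeOperad (oneOp K)).associator (freeGen (oneOp K) (symGen K))}

/-- The operad of com.-admissible algebras. -/
def ComAdm : SymOperad K := quadraticOperad (oneOp K) (comAdmRel K)

/-- The Koszul dual of the operad of symmetric Leibniz algebras. -/
def sLeibDual : SymOperad K := koszulDual (oneOp K) (sLeibRel K)

variable {K} {A : Type w} [AddCommGroup A] [Module K A]

theorem update_pair_one {A : Type w} [DecidableEq (Fin 2)] (a b z : A) :
    Function.update ![a, b] 1 z = ![a, z] := by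
  funext i
  fin_cases i <;> simp

/-- The bilinear map `(a, b) ↦ φ(p)(a, b)` that a binary operation `p ∈ P(2)` induces on a
`P`-algebra `A` with structure morphism `φ`. -/
def SymOperad.Hom.mul {P : SymOperad.{u, v} K} (φ : P.Hom (SymOperad.endOperad K A))
    (p : P.obj (Fin 2)) : A →ₗ[K] A →ₗ[K] A :=
  let f : MultilinearMap K (fun _ : Fin 2 => A) A := φ.app (Fin 2) p
  LinearMap.mk₂ K (fun a b => f ![a, b])
    (fun a a' b => f.cons_add ![b] a a')
    (fun c a b => f.cons_smul ![b] c a)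
    (fun a b b' => by
      have h2 := f.map_update_add ![a, b] 1 b b'
      simpa only [update_pair_one] using h2)
    (fun c a b => by
      have h2 := f.map_update_smul ![a, b] 1 c b
      simpa only [update_pair_one] using h2)

/-- Symmetric Leibniz algebras: the left and the right Leibniz identity hold. -/
def IsSymLeibniz (μ : A →ₗ[K] A →ₗ[K] A) : Prop :=
  (∀ a b c, μ a (μ b c) = μ (μ a b) c + μ b (μ a c)) ∧
  (∀ a b c, μ (μ a b) c = μ a (μ b c) + μ (μ a c) b)

/-- Com.-admissible algebras: `a ◇ b = a · b + b · a` is commutative and associative. -/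
def IsComAdmissible (μ : A →ₗ[K] A →ₗ[K] A) : Prop :=
  (∀ a b, (μ + μ.flip) a b = (μ + μ.flip) b a) ∧
  (∀ a b c, (μ + μ.flip) ((μ + μ.flip) a b) c = (μ + μ.flip) a ((μ + μ.flip) b c))

end Examples

end

/-!
The free operad `F(E)` is treated through its universal property (`freeLift`, `free_hom_ext`): an
`S₂`-equivariant map from `E` to the binary operations of an operad extends uniquely to `F(E)`.

*The space `F(E)(3)`.* The three copies of `E ⊗ E` span `F(E)(3)`, because linear combinations of
binary trees are closed under composition, hence exhaust `F(E)` (`isTreeSum`), and a binary tree with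
three leaves is, up to passing to opposite generators, one of `μ(ν(xₜ, xₜ₊₁), xₜ₊₂)`
(`isSmall_node`). They are independent, because `F(E)` acts on the multilinear part of the free
algebra on three letters, and evaluating this action on the letters recovers the components in the
three copies (`cubicMap_injective`).

*The Leibniz relations.* The sum of the two Leibniz identities is `(x · y) ◇ z = 0`, and symmetrizing
each of them gives `(x ◇ y) · z = 0 = z · (x ◇ y)`. Modulo these, a cubic operation is a combination
of the three iterated brackets (`comb_sub_mem`), and the Leibniz identity becomes the Jacobi identity
(`jacobi_mem`). Conversely the condition that the coefficients of the three iterated brackets are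
equal is stable under `S₃` and holds for both Leibniz identities. So it describes the relations
(`sLeibRel_eq`), which have codimension two, and `R^⊥` is spanned by the two differences of these
coefficients (`orthComplement_eq_span`). As `[,]^*` is symmetric, the first difference is the
associator of `[,]^*` and generates the second one under the three-cycle.

*The isomorphism.* Exchanging the roles of the two basis vectors, `[,]^* ↦ ◇` and `◇^* ↦ [,]`, is an
`S₂`-equivariant isomorphism `E^∨ ≅ E`, since both `[,]^*` and `◇` are symmetric and both `◇^*` and
`[,]` are antisymmetric. It carries the associator of `[,]^*` to that of `◇`, so that it and its
inverse descend to the quotient operads.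

*Algebras.* By the universal properties a morphism from `P(E, R)` to an endomorphism operad is a
multiplication satisfying the relations (`bijOn_mul`), and the relations evaluate to the defining
identities.
-/

noncomputable section

/-! ### Morphisms out of free and quotient operads -/

namespace SymOperad

variable {K : Type u} [Field K]

theorem Hom.ext_app {P : SymOperad.{u, v₁} K} {Q : SymOperad.{u, v₂} K} {f g : Hom P Q}
    (h : ∀ (I : Type) [Finite I] (p : P.obj I), f.app I p = g.app I p) : f = g := by
  obtain ⟨f, _, _, _⟩ := f
  obtain ⟨g, _, _, _⟩ := g
  have : @f = @g := by
    funext I _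
    exact LinearMap.ext (h I)
  subst this
  rfl

/-- The identity morphism of an operad. -/
def Hom.id (P : SymOperad.{u, v} K) : Hom P P where
  app _ _ := LinearMap.id
  app_relabel _ _ := rfl
  app_one := rfl
  app_comp _ _ := rfl

/-- The composite `g ∘ f` of morphisms of operads. -/
def Hom.comp {P : SymOperad.{u, v} K} {Q : SymOperad.{u, v₁} K} {S : SymOperad.{u, v₂} K}
    (g : Hom Q S) (f : Hom P Q) : Hom P S where
  app I _ := g.app I ∘ₗ f.app I
  app_relabel σ p := by simp [f.app_relabel, g.app_relabel]
  app_one := by simp [f.app_one, g.app_one]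
  app_comp p q := by simp [f.app_comp, g.app_comp]

theorem Hom.isIso_of_inverse {P : SymOperad.{u, v₁} K} {Q : SymOperad.{u, v₂} K} (f : Hom P Q)
    (g : Hom Q P) (hgf : g.comp f = Hom.id P) (hfg : f.comp g = Hom.id Q) : f.IsIso := by
  intro I _
  refine Function.bijective_iff_has_inverse.2 ⟨g.app I, fun x => ?_, fun x => ?_⟩
  · exact LinearMap.congr_fun (congrArg (fun h : Hom P P => h.app I) hgf) x
  · exact LinearMap.congr_fun (congrArg (fun h : Hom Q Q => h.app I) hfg) x

theorem comp_eq_zero (P : SymOperad.{u, v} K) {I : Type} [Finite I] {J : I → Type}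
    [∀ i, Finite (J i)] (p : P.obj I) (q : ∀ i, P.obj (J i)) (i : I) (h : q i = 0) :
    P.comp p q = 0 :=
  (P.comp p).map_coord_zero i h

/-- The kernel of a morphism of operads. -/
def Hom.ker {P : SymOperad.{u, v₁} K} {Q : SymOperad.{u, v₂} K} (f : Hom P Q) : P.Ideal where
  carrier I _ := LinearMap.ker (f.app I)
  relabel_mem σ p hp := by
    rw [LinearMap.mem_ker] at hp ⊢
    rw [f.app_relabel, hp, map_zero]
  comp_mem_left q hp := by
    rw [LinearMap.mem_ker] at hp ⊢
    rw [f.app_comp, hp, map_zero, zero_apply]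
  comp_mem_right p q i hq := by
    rw [LinearMap.mem_ker] at hq ⊢
    rw [f.app_comp]
    exact Q.comp_eq_zero _ _ i hq

/-- The morphism out of a quotient operad that is induced by a morphism vanishing on the ideal. -/
def Hom.quotientLift {P : SymOperad.{u, v₁} K} {Q : SymOperad.{u, v₂} K} (f : Hom P Q)
    (𝔞 : P.Ideal) (h : ∀ (I : Type) [Finite I], 𝔞.carrier I ≤ LinearMap.ker (f.app I)) :
    Hom (P.quotient 𝔞) Q where
  app I _ := (𝔞.carrier I).liftQ (f.app I) (h I)
  app_relabel σ p := by
    obtain ⟨p, rfl⟩ := Submodule.Quotient.mk_surjective _ p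
    exact f.app_relabel σ p
  app_one := f.app_one
  app_comp p q := by
    obtain ⟨p, rfl⟩ := Submodule.Quotient.mk_surjective _ p
    obtain ⟨q, rfl⟩ := 𝔞.exists_rep q
    refine Eq.trans ?_ (f.app_comp p q)
    exact congrArg _ (𝔞.quotCompLin_mk p q)

/-- The projection onto a quotient operad. -/
def quotientHom (P : SymOperad.{u, v} K) (𝔞 : P.Ideal) : Hom P (P.quotient 𝔞) where
  app I _ := P.quotientMk 𝔞 I
  app_relabel _ _ := rfl
  app_one := rfl
  app_comp p q := (𝔞.quotCompLin_mk p q).symm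

theorem Hom.app_leftComb {P : SymOperad.{u, v₁} K} {Q : SymOperad.{u, v₂} K} (f : Hom P Q)
    (p q : P.obj (Fin 2)) :
    f.app (Fin 3) (P.leftComb p q) = Q.leftComb (f.app (Fin 2) p) (f.app (Fin 2) q) := by
  unfold leftComb graft
  rw [f.app_relabel, f.app_relabel, f.app_comp]
  congr 3
  funext i
  fin_cases i
  · rfl
  · exact f.app_one

theorem Hom.app_rightComb {P : SymOperad.{u, v₁} K} {Q : SymOperad.{u, v₂} K} (f : Hom P Q)
    (p q : P.obj (Fin 2)) :
    f.app (Fin 3) (P.rightComb p q) = Q.rightComb (f.app (Fin 2) p) (f.app (Fin 2) q) := by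
  unfold rightComb graft
  rw [f.app_relabel, f.app_relabel, f.app_comp]
  congr 3
  funext i
  fin_cases i
  · exact f.app_one
  · rfl

end SymOperad

section FreeLift

open SymOperad

variable {K : Type u} [Field K] {E : Type v} [AddCommGroup E] [Module K E]

/-- The value of a formal operadic expression in an operad, for given values of the generators. -/
def FreePre.eval (Q : SymOperad.{u, w} K) (φ : E →ₗ[K] Q.obj (Fin 2)) :
    ∀ {I : Type} [Finite I], FreePre K E I → Q.obj I
  | _, _, .gen e => φ e
  | _, _, .one => Q.one
  | _, _, @FreePre.relabel _ _ I _ _ _ σ p => Q.relabel σ (FreePre.eval Q φ (I := I) p)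
  | _, _, @FreePre.comp _ _ I _ J _ p q =>
    Q.comp (FreePre.eval Q φ (I := I) p) (fun i => FreePre.eval Q φ (I := J i) (q i))
  | _, _, @FreePre.zero _ _ _ _ => 0
  | _, _, @FreePre.add _ _ I _ p q =>
    FreePre.eval Q φ (I := I) p + FreePre.eval Q φ (I := I) q
  | _, _, @FreePre.smul _ _ I _ c p => c • FreePre.eval Q φ (I := I) p

variable {ρ : Representation K (Equiv.Perm (Fin 2)) E} {Q : SymOperad.{u, w} K}

theorem FreePre.eval_update (φ : E →ₗ[K] Q.obj (Fin 2)) {I : Type} [DecidableEq I]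
    {J : I → Type} [∀ i, Finite (J i)] (q : ∀ i, FreePre K E (J i)) (i : I)
    (x : FreePre K E (J i)) :
    (fun j => (Function.update q i x j).eval Q φ) =
      Function.update (fun j => (q j).eval Q φ) i (x.eval Q φ) := by
  funext j
  by_cases h : j = i
  · subst h; simp
  · simp [h]

theorem FreeRel.eval_eq {φ : E →ₗ[K] Q.obj (Fin 2)}
    (hφ : ∀ σ e, φ (ρ σ e) = Q.relabel σ (φ e)) {I : Type} [Finite I] {p q : FreePre K E I}
    (h : FreeRel ρ p q) : p.eval Q φ = q.eval Q φ := by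
  induction h with
  | refl p => rfl
  | symm _ ih => exact ih.symm
  | trans _ _ ih₁ ih₂ => exact ih₁.trans ih₂
  | relabel_congr σ _ ih => simp only [FreePre.eval, ih]
  | comp_congr _ _ ih₁ ih₂ => simp only [FreePre.eval, ih₁, ih₂]
  | add_congr _ _ ih₁ ih₂ => simp only [FreePre.eval, ih₁, ih₂]
  | smul_congr c _ ih => simp only [FreePre.eval, ih]
  | add_assoc p q r => exact _root_.add_assoc _ _ _
  | add_comm p q => exact _root_.add_comm _ _
  | zero_add p => exact _root_.zero_add _
  | one_smul p => exact _root_.one_smul _ _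
  | mul_smul a b p => exact SemigroupAction.mul_smul _ _ _
  | smul_add a p q => exact _root_.smul_add _ _ _
  | add_smul a b p => exact _root_.add_smul _ _ _
  | zero_smul p => exact _root_.zero_smul _ _
  | relabel_add σ p q => exact map_add _ _ _
  | relabel_smul σ c p => exact map_smul _ _ _
  | comp_add_left p p' q => simp only [FreePre.eval, map_add, add_apply]
  | comp_smul_left c p q => simp only [FreePre.eval, map_smul, smul_apply]
  | comp_add_right p q i x y =>
    simp only [FreePre.eval, FreePre.eval_update, MultilinearMap.map_update_add]
  | comp_smul_right p q i c x =>
    simp only [FreePre.eval, FreePre.eval_update, MultilinearMap.map_update_smul]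
  | relabel_refl p => exact Q.relabel_refl _
  | relabel_trans σ τ p => exact Q.relabel_trans _ _ _
  | comp_relabel_left σ p q => exact Q.comp_relabel_left _ _ _
  | comp_relabel_right τ p q => exact Q.comp_relabel_right _ _ _
  | one_comp q => exact Q.one_comp _
  | comp_one p => exact Q.comp_one _
  | @comp_assoc I _ J _ L _ p q r =>
    exact Q.comp_assoc (p.eval Q φ) (fun i => (q i).eval Q φ) (fun i j => (r i j).eval Q φ)
  | gen_add e e' => exact map_add _ _ _
  | gen_smul c e => exact map_smul _ _ _
  | gen_perm σ e => exact hφ σ e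

/-- The morphism from the free operad that extends an equivariant map on the generators. -/
def freeLift (φ : E →ₗ[K] Q.obj (Fin 2)) (hφ : ∀ σ e, φ (ρ σ e) = Q.relabel σ (φ e)) :
    Hom (freeOperad ρ) Q where
  app I _ :=
    { toFun := Quotient.lift (s := freeSetoid ρ I) (FreePre.eval Q φ)
        (fun _ _ h => FreeRel.eval_eq hφ h)
      map_add' := by
        intro x y
        obtain ⟨x, rfl⟩ := FreeObj.mk_surj x
        obtain ⟨y, rfl⟩ := FreeObj.mk_surj y
        rfl
      map_smul' := by
        intro c x
        obtain ⟨x, rfl⟩ := FreeObj.mk_surj x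
        rfl }
  app_relabel σ p := by
    obtain ⟨p, rfl⟩ := FreeObj.mk_surj p
    rfl
  app_one := rfl
  app_comp p q := by
    obtain ⟨p, rfl⟩ := FreeObj.mk_surj p
    obtain ⟨q, rfl⟩ := FreeObj.fam_surj q
    exact congrArg (Quotient.lift (s := freeSetoid ρ _) (FreePre.eval Q φ)
        (fun _ _ h => FreeRel.eval_eq hφ h)) (FreeObj.comp_mk ρ p q)

theorem freeLift_gen (φ : E →ₗ[K] Q.obj (Fin 2)) (hφ : ∀ σ e, φ (ρ σ e) = Q.relabel σ (φ e))
    (e : E) : (freeLift φ hφ).app (Fin 2) (freeGen ρ e) = φ e := rfl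

theorem freeGen_perm (ρ : Representation K (Equiv.Perm (Fin 2)) E) (σ : Equiv.Perm (Fin 2))
    (e : E) : freeGen ρ (ρ σ e) = (freeOperad ρ).relabel σ (freeGen ρ e) :=
  FreeObj.mk_eq (FreeRel.gen_perm σ e)

/-- Structural induction on the operations of the free operad. -/
theorem freeOperad_induction {motive : ∀ (I : Type) [Finite I], (freeOperad ρ).obj I → Prop}
    (gen : ∀ e, motive (Fin 2) (freeGen ρ e)) (one : motive Unit (freeOperad ρ).one)
    (relabel : ∀ {I J : Type} [Finite I] [Finite J] (σ : I ≃ J) (p : (freeOperad ρ).obj I),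
      motive I p → motive J ((freeOperad ρ).relabel σ p))
    (comp : ∀ {I : Type} [Finite I] {J : I → Type} [∀ i, Finite (J i)]
      (p : (freeOperad ρ).obj I) (q : ∀ i, (freeOperad ρ).obj (J i)), motive I p →
      (∀ i, motive (J i) (q i)) → motive (Σ i, J i) ((freeOperad ρ).comp p q))
    (zero : ∀ (I : Type) [Finite I], motive I 0)
    (add : ∀ {I : Type} [Finite I] (p q : (freeOperad ρ).obj I), motive I p → motive I q →
      motive I (p + q))
    (smul : ∀ {I : Type} [Finite I] (c : K) (p : (freeOperad ρ).obj I), motive I p →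
      motive I (c • p))
    {I : Type} [Finite I] (p : (freeOperad ρ).obj I) : motive I p := by
  obtain ⟨p, rfl⟩ := FreeObj.mk_surj p
  induction p with
  | gen e => exact gen e
  | one => exact one
  | relabel σ p ih => exact relabel σ _ ih
  | comp p q ih₁ ih₂ =>
    have h := comp (FreeObj.mk ρ p) (fun i => FreeObj.mk ρ (q i)) ih₁ ih₂
    have h' : (freeOperad ρ).comp (FreeObj.mk ρ p) (fun i => FreeObj.mk ρ (q i)) =
        FreeObj.mk ρ (p.comp q) := FreeObj.comp_mk ρ p q
    rwa [h'] at h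
  | zero I => exact zero I
  | add p q ih₁ ih₂ => exact add _ _ ih₁ ih₂
  | smul c p ih => exact smul c _ ih

theorem free_hom_ext {f g : Hom (freeOperad ρ) Q}
    (h : ∀ e, f.app (Fin 2) (freeGen ρ e) = g.app (Fin 2) (freeGen ρ e)) : f = g := by
  refine Hom.ext_app fun I _ p => ?_
  refine freeOperad_induction (motive := fun I _ p => f.app I p = g.app I p) h ?_ ?_ ?_ ?_ ?_ ?_ p
  · rw [f.app_one, g.app_one]
  · intro I J _ _ σ p hp
    rw [f.app_relabel, g.app_relabel, hp]
  · intro I _ J _ p q hp hq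
    rw [f.app_comp, g.app_comp, hp]
    exact congrArg _ (funext hq)
  · intro I _
    rw [map_zero, map_zero]
  · intro I _ p q hp hq
    rw [map_add, map_add, hp, hq]
  · intro I _ c p hp
    rw [map_smul, map_smul, hp]

/-- The morphism from `P(E, R)` that extends an equivariant map on the generators satisfying the
relations. -/
def quadraticLift {R : Submodule K ((freeOperad ρ).obj (Fin 3))} (φ : E →ₗ[K] Q.obj (Fin 2))
    (hφ : ∀ σ e, φ (ρ σ e) = Q.relabel σ (φ e))
    (hR : ∀ x ∈ R, (freeLift φ hφ).app (Fin 3) x = 0) : Hom (quadraticOperad ρ R) Q :=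
  (freeLift φ hφ).quotientLift _ fun _ _ _ hx => hx (freeLift φ hφ).ker hR

theorem quadraticLift_gen {R : Submodule K ((freeOperad ρ).obj (Fin 3))}
    (φ : E →ₗ[K] Q.obj (Fin 2)) (hφ : ∀ σ e, φ (ρ σ e) = Q.relabel σ (φ e))
    (hR : ∀ x ∈ R, (freeLift φ hφ).app (Fin 3) x = 0) (e : E) :
    (quadraticLift φ hφ hR).app (Fin 2) (quadraticGen ρ R e) = φ e := rfl

theorem quadratic_hom_ext {R : Submodule K ((freeOperad ρ).obj (Fin 3))}
    {f g : Hom (quadraticOperad ρ R) Q}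
    (h : ∀ e, f.app (Fin 2) (quadraticGen ρ R e) = g.app (Fin 2) (quadraticGen ρ R e)) :
    f = g := by
  have key : f.comp ((freeOperad ρ).quotientHom _) = g.comp ((freeOperad ρ).quotientHom _) :=
    free_hom_ext h
  refine Hom.ext_app fun I _ p => ?_
  obtain ⟨p, rfl⟩ := Submodule.Quotient.mk_surjective _ p
  exact LinearMap.congr_fun (congrArg (fun k : Hom (freeOperad ρ) Q => k.app I) key) p

theorem quadraticGen_perm (R : Submodule K ((freeOperad ρ).obj (Fin 3)))
    (σ : Equiv.Perm (Fin 2)) (e : E) :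
    quadraticGen ρ R (ρ σ e) = (quadraticOperad ρ R).relabel σ (quadraticGen ρ R e) :=
  congrArg ((freeOperad ρ).quotientMk _ (Fin 2)) (freeGen_perm ρ σ e)

/-- The relations vanish in `P(E, R)`. -/
theorem quotientHom_eq_zero {R : Submodule K ((freeOperad ρ).obj (Fin 3))}
    {x : (freeOperad ρ).obj (Fin 3)} (hx : x ∈ R) :
    ((freeOperad ρ).quotientHom (SymOperad.Ideal.span (freeOperad ρ)
      (R : Set ((freeOperad ρ).obj (Fin 3))))).app (Fin 3) x = 0 :=
  (Submodule.Quotient.mk_eq_zero _).2 fun _ h => h hx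

/-- A morphism of operads that is zero on a set is zero on the sub-`S₃`-module it generates. -/
theorem app_eq_zero_of_mem_permSpan (f : Hom (freeOperad ρ) Q)
    {S : Set ((freeOperad ρ).obj (Fin 3))} (hS : ∀ x ∈ S, f.app (Fin 3) x = 0)
    {x : (freeOperad ρ).obj (Fin 3)} (hx : x ∈ permSpan ρ S) : f.app (Fin 3) x = 0 := by
  have : permSpan ρ S ≤ LinearMap.ker (f.app (Fin 3)) := by
    refine Submodule.span_le.2 ?_
    rintro _ ⟨σ, y, hy, rfl⟩
    rw [SetLike.mem_coe, LinearMap.mem_ker, f.app_relabel, hS y hy, map_zero]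
  exact this hx

end FreeLift

/-! ### Relabelling compositions of two binary operations -/

namespace SymOperad

variable {K : Type u} [Field K] (P : SymOperad.{u, v} K)

theorem relabel_mul {I : Type} [Finite I] (σ τ : Equiv.Perm I) (p : P.obj I) :
    P.relabel (σ * τ) p = P.relabel σ (P.relabel τ p) :=
  P.relabel_trans τ σ p

theorem relabel_symm_relabel {I J : Type} [Finite I] [Finite J] (σ : I ≃ J) (p : P.obj I) :
    P.relabel σ.symm (P.relabel σ p) = p := by
  rw [← P.relabel_trans, Equiv.self_trans_symm, P.relabel_refl]

/-- `p(q(x₁, x₀), x₂)` is `p(q^op(x₀, x₁), x₂)`. -/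
theorem relabel_swap_leftComb (p q : P.obj (Fin 2)) :
    P.relabel (Equiv.swap 0 1) (P.leftComb p q) =
      P.leftComb p (P.relabel (Equiv.swap 0 1) q) := by
  let α : ∀ i, pairArity (Fin 2) Unit i ≃ pairArity (Fin 2) Unit i
    | 0 => (Equiv.swap 0 1 : Equiv.Perm (Fin 2))
    | 1 => Equiv.refl Unit
  have h : P.pairFam (A := Fin 2) (P.relabel (Equiv.swap 0 1) q) P.one =
      fun i => P.relabel (α i) (P.pairFam (A := Fin 2) q P.one i) := by
    funext i
    fin_cases i
    · rfl
    · exact (P.relabel_refl _).symm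
  unfold leftComb graft
  rw [h, P.comp_relabel_right]
  simp only [← P.relabel_trans]
  congr 2
  ext ⟨i, x⟩
  fin_cases i
  · revert x
    show ∀ x : Fin 2, _
    intro x
    fin_cases x <;> rfl
  · rfl

/-- `p(x₀, q(x₁, x₂))` is `p^op(q(x₁, x₂), x₀)`. -/
theorem rightComb_eq (p q : P.obj (Fin 2)) :
    P.rightComb p q = P.relabel cyc (P.leftComb (P.relabel (Equiv.swap 0 1) p) q) := by
  let α : ∀ i, pairArity Unit (Fin 2) i ≃ pairArity (Fin 2) Unit (Equiv.swap 0 1 i)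
    | 0 => Equiv.refl Unit
    | 1 => Equiv.refl (Fin 2)
  have h : (fun i => P.pairFam (B := Unit) q P.one (Equiv.swap 0 1 i)) =
      fun i => P.relabel (α i) (P.pairFam (A := Unit) P.one q i) := by
    funext i
    fin_cases i
    · exact (P.relabel_refl _).symm
    · exact (P.relabel_refl _).symm
  unfold leftComb rightComb graft
  rw [P.comp_relabel_left, h, P.comp_relabel_right]
  simp only [← P.relabel_trans]
  congr 2
  ext ⟨i, x⟩
  fin_cases i
  · rfl
  · revert x
    show ∀ x : Fin 2, _
    intro x
    fin_cases x <;> rfl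

end SymOperad

/-- Every permutation of three letters is a power of the three-cycle, or such a power times the
transposition of the first two letters. -/
theorem perm_three_eq (π : Equiv.Perm (Fin 3)) :
    ∃ t : Fin 3, π = cyc ^ (t : ℕ) ∨ π = cyc ^ (t : ℕ) * Equiv.swap 0 1 := by
  revert π
  unfold cyc
  decide

section Cubic

open SymOperad

variable {K : Type u} [Field K] {E : Type v} [AddCommGroup E] [Module K E]
  (ρ : Representation K (Equiv.Perm (Fin 2)) E)

theorem cubicMap_single (t : Fin 3) (μ ν : E) :
    cubicMap ρ (Pi.single t (μ ⊗ₜ ν)) = (freeOperad ρ).relabel (cyc ^ (t : ℕ))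
      ((freeOperad ρ).leftComb (freeGen ρ μ) (freeGen ρ ν)) := by
  unfold cubicMap
  rw [LinearMap.lsum_piSingle]
  rfl

theorem relabel_leftComb_mem_range (π : Equiv.Perm (Fin 3)) (μ ν : E) :
    (freeOperad ρ).relabel π ((freeOperad ρ).leftComb (freeGen ρ μ) (freeGen ρ ν)) ∈
      LinearMap.range (cubicMap ρ) := by
  obtain ⟨t, rfl | rfl⟩ := perm_three_eq π
  · exact ⟨_, cubicMap_single ρ t μ ν⟩
  · rw [relabel_mul, relabel_swap_leftComb, ← freeGen_perm]
    exact ⟨_, cubicMap_single ρ t μ _⟩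

/-! ### The free operad is spanned by trees -/

/-- The operations of the free operad that are linear combinations of binary trees with labelled
leaves and with vertices decorated by generators. -/
inductive IsTreeSum : ∀ (I : Type) [Finite I], (freeOperad ρ).obj I → Prop
  | one : IsTreeSum Unit (freeOperad ρ).one
  | node (e : E) {J : Fin 2 → Type} [∀ i, Finite (J i)] (q : ∀ i, (freeOperad ρ).obj (J i)) :
      (∀ i, IsTreeSum (J i) (q i)) →
        IsTreeSum (Σ i, J i) ((freeOperad ρ).comp (freeGen ρ e) q)
  | relabel {I J : Type} [Finite I] [Finite J] (σ : I ≃ J) (p : (freeOperad ρ).obj I) :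
      IsTreeSum I p → IsTreeSum J ((freeOperad ρ).relabel σ p)
  | zero (I : Type) [Finite I] : IsTreeSum I 0
  | add {I : Type} [Finite I] (p q : (freeOperad ρ).obj I) :
      IsTreeSum I p → IsTreeSum I q → IsTreeSum I (p + q)
  | smul {I : Type} [Finite I] (c : K) (p : (freeOperad ρ).obj I) :
      IsTreeSum I p → IsTreeSum I (c • p)

variable {ρ}

theorem IsTreeSum.comp {I : Type} [Finite I] {p : (freeOperad ρ).obj I} (hp : IsTreeSum ρ I p) :
    ∀ {J : I → Type} [∀ i, Finite (J i)] (q : ∀ i, (freeOperad ρ).obj (J i)),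
      (∀ i, IsTreeSum ρ (J i) (q i)) → IsTreeSum ρ (Σ i, J i) ((freeOperad ρ).comp p q) := by
  induction hp with
  | one =>
    intro J _ q hq
    have h := (freeOperad ρ).relabel_symm_relabel
      (Equiv.uniqueSigma (fun _ : Unit => J ())) ((freeOperad ρ).comp (freeOperad ρ).one q)
    rw [← h]
    refine IsTreeSum.relabel _ _ ?_
    have h1 := (freeOperad ρ).one_comp (q ())
    have h2 := hq ()
    rw [← h1] at h2
    exact h2
  | @node e L _ r _ ih =>
    intro J _ q hq
    have h := (freeOperad ρ).comp_assoc (L := fun i j => J ⟨i, j⟩) (freeGen ρ e) r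
      (fun i j => q ⟨i, j⟩)
    have h' := (freeOperad ρ).relabel_symm_relabel (Equiv.sigmaAssoc fun i j => J ⟨i, j⟩)
      ((freeOperad ρ).comp ((freeOperad ρ).comp (freeGen ρ e) r) q)
    rw [← h']
    refine IsTreeSum.relabel _ _ ?_
    have h2 : IsTreeSum ρ _ ((freeOperad ρ).comp (freeGen ρ e)
        (fun i => (freeOperad ρ).comp (r i) (fun j => q ⟨i, j⟩))) :=
      IsTreeSum.node e _ (fun i => ih i _ (fun j => hq ⟨i, j⟩))
    rw [← h] at h2
    exact h2
  | relabel σ p _ ih =>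
    intro J _ q hq
    rw [comp_relabel_left]
    exact IsTreeSum.relabel _ _ (ih _ fun i => hq (σ i))
  | zero I =>
    intro J _ q _
    rw [map_zero]
    exact IsTreeSum.zero _
  | add p p' _ _ ih₁ ih₂ =>
    intro J _ q hq
    rw [map_add]
    exact IsTreeSum.add _ _ (ih₁ q hq) (ih₂ q hq)
  | smul c p _ ih =>
    intro J _ q hq
    rw [map_smul]
    exact IsTreeSum.smul _ _ (ih q hq)

theorem isTreeSum {I : Type} [Finite I] (p : (freeOperad ρ).obj I) : IsTreeSum ρ I p := by
  refine freeOperad_induction (motive := fun I _ p => IsTreeSum ρ I p) ?_ .one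
    (fun σ p hp => .relabel σ p hp) (fun p q hp hq => hp.comp q hq) (fun I _ => .zero I)
    (fun p q => .add p q) (fun c p => .smul c p) p
  intro e
  rw [← (freeOperad ρ).comp_one (freeGen ρ e)]
  exact .relabel _ _ (.node e _ fun _ => .one)

/-! ### The operations with at most three inputs -/

variable (ρ) in
/-- The description of an operation of the free operad when it has at most three inputs: zero
without inputs, a multiple of the unit with one input, a generator with two inputs, and in the image
of `cubicMap` with three inputs. -/
structure IsSmall (I : Type) [Finite I] (p : (freeOperad ρ).obj I) : Prop where
  zero : IsEmpty I → p = 0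
  one : ∀ σ : Unit ≃ I, ∃ c : K, p = (freeOperad ρ).relabel σ (c • (freeOperad ρ).one)
  two : ∀ σ : Fin 2 ≃ I, ∃ e : E, p = (freeOperad ρ).relabel σ (freeGen ρ e)
  three : ∀ σ : Fin 3 ≃ I, ∃ g, p = (freeOperad ρ).relabel σ (cubicMap ρ g)

theorem isSmall_zero (I : Type) [Finite I] : IsSmall ρ I 0 where
  zero _ := rfl
  one σ := ⟨0, by simp⟩
  two σ := ⟨0, by simp⟩
  three σ := ⟨0, by simp⟩

theorem IsSmall.relabel {I J : Type} [Finite I] [Finite J] (τ : I ≃ J)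
    {p : (freeOperad ρ).obj I} (hp : IsSmall ρ I p) :
    IsSmall ρ J ((freeOperad ρ).relabel τ p) where
  zero h := by
    have := τ.isEmpty
    rw [hp.zero this, map_zero]
  one σ := by
    obtain ⟨c, h⟩ := hp.one (σ.trans τ.symm)
    refine ⟨c, ?_⟩
    rw [h, ← relabel_trans, Equiv.trans_assoc, Equiv.symm_trans_self, Equiv.trans_refl]
  two σ := by
    obtain ⟨c, h⟩ := hp.two (σ.trans τ.symm)
    refine ⟨c, ?_⟩
    rw [h, ← relabel_trans, Equiv.trans_assoc, Equiv.symm_trans_self, Equiv.trans_refl]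
  three σ := by
    obtain ⟨c, h⟩ := hp.three (σ.trans τ.symm)
    refine ⟨c, ?_⟩
    rw [h, ← relabel_trans, Equiv.trans_assoc, Equiv.symm_trans_self, Equiv.trans_refl]

theorem IsSmall.add {I : Type} [Finite I] {p q : (freeOperad ρ).obj I} (hp : IsSmall ρ I p)
    (hq : IsSmall ρ I q) : IsSmall ρ I (p + q) where
  zero h := by rw [hp.zero h, hq.zero h, add_zero]
  one σ := by
    obtain ⟨c, h⟩ := hp.one σ
    obtain ⟨d, h'⟩ := hq.one σ
    exact ⟨c + d, by rw [h, h', add_smul, map_add]⟩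
  two σ := by
    obtain ⟨c, h⟩ := hp.two σ
    obtain ⟨d, h'⟩ := hq.two σ
    exact ⟨c + d, by rw [h, h', map_add, map_add]⟩
  three σ := by
    obtain ⟨c, h⟩ := hp.three σ
    obtain ⟨d, h'⟩ := hq.three σ
    exact ⟨c + d, by rw [h, h', map_add, map_add]⟩

theorem IsSmall.smul {I : Type} [Finite I] (a : K) {p : (freeOperad ρ).obj I}
    (hp : IsSmall ρ I p) : IsSmall ρ I (a • p) where
  zero h := by rw [hp.zero h, smul_zero]
  one σ := by
    obtain ⟨c, h⟩ := hp.one σ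
    exact ⟨a * c, by rw [h, mul_smul]; simp only [map_smul]⟩
  two σ := by
    obtain ⟨c, h⟩ := hp.two σ
    exact ⟨a • c, by rw [h, map_smul, map_smul]⟩
  three σ := by
    obtain ⟨c, h⟩ := hp.three σ
    exact ⟨a • c, by rw [h, map_smul, map_smul]⟩

theorem isSmall_one : IsSmall ρ Unit (freeOperad ρ).one where
  zero h := h.elim ()
  one σ := ⟨1, by rw [Subsingleton.elim σ (Equiv.refl Unit), relabel_refl, one_smul]⟩
  two σ := by simpa using Nat.card_congr σ
  three σ := by simpa using Nat.card_congr σ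

/-- A vertex whose left branch has two leaves and whose right branch is a leaf. -/
theorem exists_comp_eq_leftComb {J : Fin 2 → Type} [∀ i, Finite (J i)] (e : E)
    (q : ∀ i, (freeOperad ρ).obj (J i)) (hq : ∀ i, IsSmall ρ (J i) (q i)) (σ : Fin 2 ≃ J 0)
    (τ : Unit ≃ J 1) : ∃ (π : Fin 3 ≃ Σ i, J i) (μ ν : E),
      (freeOperad ρ).comp (freeGen ρ e) q = (freeOperad ρ).relabel π
        ((freeOperad ρ).leftComb (freeGen ρ μ) (freeGen ρ ν)) := by
  obtain ⟨ν, hν⟩ := (hq 0).two σ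
  obtain ⟨c, hc⟩ := (hq 1).one τ
  let α : ∀ i, pairArity (Fin 2) Unit i ≃ J i
    | 0 => σ
    | 1 => τ
  let f := (freeOperad ρ).pairFam (freeGen ρ ν) (freeOperad ρ).one
  have hf : q = fun i => (freeOperad ρ).relabel (α i) ((if i = 0 then (1 : K) else c) • f i) := by
    funext i
    fin_cases i
    · exact hν.trans (congrArg _ (one_smul K _).symm)
    · exact hc
  let β : (Σ i, pairArity (Fin 2) Unit i) ≃ Fin 3 := (pairEquiv (Fin 2) Unit).trans
    (((Equiv.refl (Fin 2)).sumCongr (Equiv.ofUnique Unit (Fin 1))).trans finSumFinEquiv)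
  have hβ : ∀ μ, (freeOperad ρ).leftComb (freeGen ρ μ) (freeGen ρ ν) =
      (freeOperad ρ).relabel β ((freeOperad ρ).comp (freeGen ρ μ) f) :=
    fun μ => ((freeOperad ρ).relabel_trans _ _ _).symm
  refine ⟨β.symm.trans (Equiv.sigmaCongrRight α), c • e, ν, ?_⟩
  rw [hβ, relabel_trans, relabel_symm_relabel, hf, comp_relabel_right, MultilinearMap.map_smul_univ]
  simp

theorem isSmall_node (e : E) {J : Fin 2 → Type} [∀ i, Finite (J i)]
    (q : ∀ i, (freeOperad ρ).obj (J i)) (hq : ∀ i, IsSmall ρ (J i) (q i)) :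
    IsSmall ρ (Σ i, J i) ((freeOperad ρ).comp (freeGen ρ e) q) := by
  by_cases hJ : ∃ i, IsEmpty (J i)
  · obtain ⟨i, hi⟩ := hJ
    rw [comp_eq_zero _ _ _ i ((hq i).zero hi)]
    exact isSmall_zero _
  simp only [not_exists, not_isEmpty_iff] at hJ
  have hpos : ∀ i, 0 < Nat.card (J i) := fun i => Nat.card_pos
  have hcard : Nat.card (Σ i, J i) = Nat.card (J 0) + Nat.card (J 1) := by
    rw [Nat.card_sigma, Fin.sum_univ_two]
  have equivOfCard : ∀ i (n : ℕ), Nat.card (J i) = n → Nonempty (Fin n ≃ J i) := fun i n h =>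
    ⟨(Finite.equivFinOfCardEq h).symm⟩
  have unitEquiv : ∀ i, Nat.card (J i) = 1 → Nonempty (Unit ≃ J i) := fun i h =>
    ⟨(Equiv.ofUnique Unit (Fin 1)).trans (equivOfCard i 1 h).some⟩
  refine ⟨fun h => ?_, fun σ => ?_, fun σ => ?_, fun σ => ?_⟩
  · exact (h.elim ⟨0, (hJ 0).some⟩)
  · have h := Nat.card_congr σ
    rw [Nat.card_unique, hcard] at h
    have h0 := hpos 0
    have h1 := hpos 1
    omega
  · have h := Nat.card_congr σ
    rw [Nat.card_fin, hcard] at h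
    have h0 := hpos 0
    have h1 := hpos 1
    have hu : ∀ i, Nonempty (Unit ≃ J i) := fun i =>
      unitEquiv i (by fin_cases i <;> simp only [Fin.zero_eta, Fin.mk_one] <;> omega)
    choose c hc using fun i => (hq i).one (hu i).some
    rw [funext hc, comp_relabel_right, MultilinearMap.map_smul_univ]
    have h2 := congrArg ((freeOperad ρ).relabel (Equiv.sigmaUnique (Fin 2) (fun _ => Unit)).symm)
      ((freeOperad ρ).comp_one (freeGen ρ e))
    rw [relabel_symm_relabel] at h2
    rw [h2, ← map_smul, ← relabel_trans, ← map_smul]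
    refine ⟨ρ ((((Equiv.sigmaUnique (Fin 2) (fun _ => Unit)).symm).trans
      (Equiv.sigmaCongrRight fun i => (hu i).some)).trans σ.symm) ((∏ i, c i) • e), ?_⟩
    rw [freeGen_perm, ← relabel_trans, Equiv.trans_assoc, Equiv.symm_trans_self, Equiv.trans_refl]
  · have h := Nat.card_congr σ
    rw [Nat.card_fin, hcard] at h
    have h0 := hpos 0
    have h1 := hpos 1
    suffices ∃ (π : Fin 3 ≃ Σ i, J i) (μ ν : E),
        (freeOperad ρ).comp (freeGen ρ e) q = (freeOperad ρ).relabel π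
          ((freeOperad ρ).leftComb (freeGen ρ μ) (freeGen ρ ν)) by
      obtain ⟨π, μ, ν, h⟩ := this
      obtain ⟨g, hg⟩ := relabel_leftComb_mem_range ρ (π.trans σ.symm) μ ν
      refine ⟨g, ?_⟩
      rw [h, hg, ← relabel_trans, Equiv.trans_assoc, Equiv.symm_trans_self, Equiv.trans_refl]
    by_cases h2 : Nat.card (J 0) = 2
    · exact exists_comp_eq_leftComb e q hq (equivOfCard 0 2 h2).some
        (unitEquiv 1 (by omega)).some
    · obtain ⟨π, μ, ν, hπ⟩ := exists_comp_eq_leftComb (J := fun i => J (Equiv.swap 0 1 i))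
        (ρ (Equiv.swap 0 1) e) (fun i => q (Equiv.swap 0 1 i)) (fun i => hq _)
        (equivOfCard 1 2 (by omega)).some (unitEquiv 0 (by omega)).some
      -- exchange the two branches by passing to the opposite generator
      have he : freeGen ρ e =
          (freeOperad ρ).relabel (Equiv.swap 0 1) (freeGen ρ (ρ (Equiv.swap 0 1) e)) := by
        rw [← freeGen_perm, ← Module.End.mul_apply, ← map_mul, Equiv.swap_mul_self, map_one,
          Module.End.one_apply]
      refine ⟨π.trans (Equiv.sigmaCongrLeft (β := J) (Equiv.swap 0 1)), μ, ν, ?_⟩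
      rw [relabel_trans, ← hπ, ← comp_relabel_left, ← he]

theorem isSmall {I : Type} [Finite I] (p : (freeOperad ρ).obj I) : IsSmall ρ I p := by
  induction isTreeSum p with
  | one => exact isSmall_one
  | node e q _ ih => exact isSmall_node e q ih
  | relabel σ p _ ih => exact ih.relabel σ
  | zero I => exact isSmall_zero I
  | add p q _ _ ih₁ ih₂ => exact ih₁.add ih₂
  | smul c p _ ih => exact ih.smul c

theorem cubicMap_surjective : Function.Surjective (cubicMap ρ) := fun p => by
  obtain ⟨g, hg⟩ := (isSmall p).three (Equiv.refl _)
  exact ⟨g, by rw [hg, relabel_refl]⟩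

end Cubic

/-! ### Evaluation in the endomorphism operad -/

section EndOperad

open SymOperad

variable {K : Type u} [Field K] {A : Type w} [AddCommGroup A] [Module K A]

/-- Bilinear multiplications, as binary operations of the endomorphism operad. -/
def binaryOp : (A →ₗ[K] A →ₗ[K] A) →ₗ[K] (endOperad K A).obj (Fin 2) where
  toFun μ :=
    ({ toFun := fun v => μ (v 0) (v 1)
       map_update_add' := by
         intro _ v i x y
         fin_cases i <;> simp
       map_update_smul' := by
         intro _ v i c x
         fin_cases i <;> simp } : MultilinearMap K (fun _ : Fin 2 => A) A)
  map_add' _ _ := rfl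
  map_smul' _ _ := rfl

/-- The value of an `I`-ary operation of the endomorphism operad on a family of vectors. -/
def endEval {I : Type} [Finite I] (v : I → A) : (endOperad K A).obj I →ₗ[K] A where
  toFun f := (show MultilinearMap K (fun _ : I => A) A from f) v
  map_add' _ _ := rfl
  map_smul' _ _ := rfl

theorem endOperad_ext {I : Type} [Finite I] {f g : (endOperad K A).obj I}
    (h : ∀ v : I → A, endEval v f = endEval v g) : f = g :=
  MultilinearMap.ext h

theorem endEval_binaryOp (μ : A →ₗ[K] A →ₗ[K] A) (v : Fin 2 → A) :
    endEval v (binaryOp μ) = μ (v 0) (v 1) := rfl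

theorem endEval_relabel {I J : Type} [Finite I] [Finite J] (σ : I ≃ J) (f : (endOperad K A).obj I)
    (v : J → A) : endEval v ((endOperad K A).relabel σ f) = endEval (fun i => v (σ i)) f := rfl

theorem endEval_leftComb (f g : (endOperad K A).obj (Fin 2)) (v : Fin 3 → A) :
    endEval v ((endOperad K A).leftComb f g) = endEval ![endEval ![v 0, v 1] g, v 2] f := by
  refine congrArg (show MultilinearMap K (fun _ : Fin 2 => A) A from f) ?_
  funext i
  fin_cases i
  · refine congrArg (show MultilinearMap K (fun _ : Fin 2 => A) A from g) ?_
    funext j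
    revert j
    show ∀ j : Fin 2, _
    intro j
    fin_cases j <;> rfl
  · rfl

theorem endEval_rightComb (f g : (endOperad K A).obj (Fin 2)) (v : Fin 3 → A) :
    endEval v ((endOperad K A).rightComb f g) = endEval ![v 0, endEval ![v 1, v 2] g] f := by
  refine congrArg (show MultilinearMap K (fun _ : Fin 2 => A) A from f) ?_
  funext i
  fin_cases i
  · rfl
  · refine congrArg (show MultilinearMap K (fun _ : Fin 2 => A) A from g) ?_
    funext j
    revert j
    show ∀ j : Fin 2, _
    intro j
    fin_cases j <;> rfl

end EndOperad

/-! ### Independence of the three copies -/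

section Injective

open SymOperad

variable {K : Type u} [Field K] {E : Type v} [AddCommGroup E] [Module K E]
  (ρ : Representation K (Equiv.Perm (Fin 2)) E)

/-- The multilinear part of the free `F(E)`-algebra on three letters `x₀`, `x₁`, `x₂`, graded by the
degree: the letters, the products `e(xₜ, xₜ₊₁)`, and the products `μ(ν(xₜ, xₜ₊₁), xₜ₊₂)`. -/
abbrev ThreeLetters (K : Type u) [Field K] (E : Type v) [AddCommGroup E] [Module K E] :=
  (Fin 3 → K) × (Fin 3 → E) × (Fin 3 → E ⊗[K] E)

/-- The multiplication of `ThreeLetters` by the generator `e`. -/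
def threeLettersMul (e : E) :
    ThreeLetters K E →ₗ[K] ThreeLetters K E →ₗ[K] ThreeLetters K E :=
  LinearMap.mk₂ K
    (fun x y => (0,
      fun t => (x.1 t * y.1 (t + 1)) • e + (x.1 (t + 1) * y.1 t) • ρ (Equiv.swap 0 1) e,
      fun t => y.1 (t + 2) • (e ⊗ₜ x.2.1 t) + x.1 (t + 2) • (ρ (Equiv.swap 0 1) e ⊗ₜ y.2.1 t)))
    (fun x x' y => by
      ext t <;> simp [TensorProduct.tmul_add] <;> module)
    (fun c x y => by
      ext t <;> simp [TensorProduct.tmul_smul] <;> module)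
    (fun x y y' => by
      ext t <;> simp [TensorProduct.tmul_add] <;> module)
    (fun c x y => by
      ext t <;> simp [TensorProduct.tmul_smul] <;> module)

theorem threeLettersMul_apply (e : E) (x y : ThreeLetters K E) :
    threeLettersMul ρ e x y = (0,
      fun t => (x.1 t * y.1 (t + 1)) • e + (x.1 (t + 1) * y.1 t) • ρ (Equiv.swap 0 1) e,
      fun t => y.1 (t + 2) • (e ⊗ₜ x.2.1 t) + x.1 (t + 2) • (ρ (Equiv.swap 0 1) e ⊗ₜ y.2.1 t)) :=
  rfl

/-- The action of the generators on `ThreeLetters`. -/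
def threeLettersAct : E →ₗ[K] (endOperad K (ThreeLetters K E)).obj (Fin 2) :=
  binaryOp ∘ₗ
    { toFun := threeLettersMul ρ
      map_add' := fun e e' => by
        refine LinearMap.ext fun x => LinearMap.ext fun y => ?_
        simp only [LinearMap.add_apply, threeLettersMul_apply]
        ext t <;> simp [TensorProduct.add_tmul] <;> module
      map_smul' := fun c e => by
        refine LinearMap.ext fun x => LinearMap.ext fun y => ?_
        simp only [LinearMap.smul_apply, threeLettersMul_apply, RingHom.id_apply]
        ext t <;> simp [← TensorProduct.smul_tmul'] <;> module }

theorem swap_swap_apply (e : E) : ρ (Equiv.swap 0 1) (ρ (Equiv.swap 0 1) e) = e := by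
  rw [← Module.End.mul_apply, ← map_mul, Equiv.swap_mul_self, map_one, Module.End.one_apply]

/-- A map on the generators is equivariant as soon as it commutes with the transposition. -/
theorem equivariant_of_swap {Q : SymOperad.{u, w} K} (φ : E →ₗ[K] Q.obj (Fin 2))
    (h : ∀ e, φ (ρ (Equiv.swap 0 1) e) = Q.relabel (Equiv.swap 0 1) (φ e)) (σ : Equiv.Perm (Fin 2))
    (e : E) : φ (ρ σ e) = Q.relabel σ (φ e) := by
  have hσ : σ = 1 ∨ σ = Equiv.swap 0 1 := by
    revert σ
    decide
  obtain rfl | rfl := hσ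
  · rw [map_one, Module.End.one_apply]
    exact (Q.relabel_refl _).symm
  · exact h e

theorem threeLettersAct_perm (σ : Equiv.Perm (Fin 2)) (e : E) :
    threeLettersAct ρ (ρ σ e) = (endOperad K (ThreeLetters K E)).relabel σ (threeLettersAct ρ e) := by
  refine equivariant_of_swap ρ _ (fun e => endOperad_ext fun v => ?_) σ e
  rw [endEval_relabel]
  change threeLettersMul ρ _ (v 0) (v 1) = threeLettersMul ρ e (v 1) (v 0)
  rw [threeLettersMul_apply, threeLettersMul_apply, swap_swap_apply]
  ext t
  · rfl
  · exact (add_comm _ _).trans (by simp only [mul_comm])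
  · exact add_comm _ _

theorem cubicMap_injective : Function.Injective (cubicMap ρ) := by
  have h0 : (finRotate 3 ^ 2) 0 = 2 := rfl
  have h1 : (finRotate 3 ^ 2) 1 = 0 := rfl
  have h2 : (finRotate 3 ^ 2) 2 = 1 := rfl
  let x : Fin 3 → ThreeLetters K E := fun i => (Pi.single i 1, 0, 0)
  let Ψ : (Fin 3 → E ⊗[K] E) →ₗ[K] (Fin 3 → E ⊗[K] E) :=
    LinearMap.snd K _ _ ∘ₗ LinearMap.snd K _ _ ∘ₗ endEval x ∘ₗ
      (freeLift (threeLettersAct ρ) (threeLettersAct_perm ρ)).app (Fin 3) ∘ₗ cubicMap ρ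
  have hΨ : Ψ = LinearMap.id := by
    refine LinearMap.pi_ext' fun t => TensorProduct.ext' fun μ ν => ?_
    change (endEval x ((freeLift (threeLettersAct ρ) (threeLettersAct_perm ρ)).app (Fin 3)
      (cubicMap ρ (Pi.single t (μ ⊗ₜ ν))))).2.2 = Pi.single t (μ ⊗ₜ ν)
    rw [cubicMap_single, Hom.app_relabel, Hom.app_leftComb, endEval_relabel, endEval_leftComb,
      freeLift_gen, freeLift_gen]
    change (threeLettersMul ρ μ (threeLettersMul ρ ν _ _) _).2.2 = _
    simp only [threeLettersMul_apply]
    fin_cases t <;> funext s <;> fin_cases s <;> simp [x, cyc, h0, h1, h2]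
  intro g g' h
  have h1 : Ψ g = Ψ g' := congrArg (fun y => (endEval x ((freeLift (threeLettersAct ρ)
    (threeLettersAct_perm ρ)).app (Fin 3) y)).2.2) h
  rwa [hΨ] at h1

theorem cubicMap_bijective : Function.Bijective (cubicMap ρ) :=
  ⟨cubicMap_injective ρ, cubicMap_surjective⟩

end Injective

/-! ### The regular representation of `S₂` -/

section OneOp

variable (K : Type u) [Field K]

theorem oneOp_swap_mulGen : oneOp K (Equiv.swap 0 1) (mulGen K) = mulOpGen K := rfl

theorem oneOp_swap_mulOpGen : oneOp K (Equiv.swap 0 1) (mulOpGen K) = mulGen K :=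
  swap_swap_apply (oneOp K) (mulGen K)

theorem oneOp_swap_lieGen : oneOp K (Equiv.swap 0 1) (lieGen K) = -lieGen K := by
  rw [lieGen, map_sub, oneOp_swap_mulGen, oneOp_swap_mulOpGen, neg_sub]

theorem oneOp_swap_symGen : oneOp K (Equiv.swap 0 1) (symGen K) = symGen K := by
  rw [symGen, map_add, oneOp_swap_mulGen, oneOp_swap_mulOpGen, add_comm]

theorem mulOpGen_eq : mulOpGen K = MonoidAlgebra.single (Equiv.swap 0 1) 1 := by
  simp [mulOpGen, mulGen, Representation.ofMulAction_single]

theorem perm_two_eq (σ : Equiv.Perm (Fin 2)) : σ = 1 ∨ σ = Equiv.swap 0 1 := by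
  revert σ
  decide

variable {K}

theorem oneOp_eq (x : OneOp K) :
    x = x.coeff 1 • mulGen K + x.coeff (Equiv.swap 0 1) • mulOpGen K := by
  have h : (Equiv.swap (0 : Fin 2) 1) ≠ 1 := by decide
  rw [mulOpGen_eq]
  ext σ
  obtain rfl | rfl := perm_two_eq σ <;> simp [mulGen, h, h.symm]

theorem signDual_swap (f : Module.Dual K (OneOp K)) (x : OneOp K) :
    signDual (oneOp K) (Equiv.swap 0 1) f x = -f (oneOp K (Equiv.swap 0 1) x) := by
  simp [signDual, Representation.dual]

variable [CharZero K]

/-- The expansion of an operation in the basis `[,]`, `◇`. -/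
theorem oneOp_eq_lie_sym (x : OneOp K) :
    x = lieGenDual K x • lieGen K + symGenDual K x • symGen K := by
  conv_lhs => rw [oneOp_eq x]
  simp only [lieGenDual, symGenDual, lieGen, symGen, LinearMap.coe_mk, AddHom.coe_mk]
  module

theorem dual_eq (f : Module.Dual K (OneOp K)) :
    f = f (lieGen K) • lieGenDual K + f (symGen K) • symGenDual K := by
  refine LinearMap.ext fun x => ?_
  conv_lhs => rw [oneOp_eq_lie_sym x]
  simp only [map_add, map_smul, smul_eq_mul, LinearMap.add_apply, LinearMap.smul_apply]
  ring

end OneOp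

/-! ### The symmetric group action on cubic operations -/

section Comb

open SymOperad

variable {K : Type u} [Field K] {E : Type v} [AddCommGroup E] [Module K E]
  (ρ : Representation K (Equiv.Perm (Fin 2)) E)

/-- The operation `μ(ν(xₜ, xₜ₊₁), xₜ₊₂)` of the free operad. -/
def comb (t : Fin 3) : E →ₗ[K] E →ₗ[K] (freeOperad ρ).obj (Fin 3) :=
  ((freeOperad ρ).leftCombLin.compl₁₂ (freeGen ρ) (freeGen ρ)).compr₂
    ((freeOperad ρ).relabel (cyc ^ (t : ℕ)))

theorem comb_apply (t : Fin 3) (μ ν : E) :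
    comb ρ t μ ν = (freeOperad ρ).relabel (cyc ^ (t : ℕ))
      ((freeOperad ρ).leftComb (freeGen ρ μ) (freeGen ρ ν)) := rfl

theorem cubicMap_single_eq_comb (t : Fin 3) (μ ν : E) :
    cubicMap ρ (Pi.single t (μ ⊗ₜ ν)) = comb ρ t μ ν := cubicMap_single ρ t μ ν

theorem leftComb_eq_comb (μ ν : E) :
    (freeOperad ρ).leftComb (freeGen ρ μ) (freeGen ρ ν) = comb ρ 0 μ ν :=
  ((freeOperad ρ).relabel_refl _).symm

theorem rightComb_eq_comb (μ ν : E) :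
    (freeOperad ρ).rightComb (freeGen ρ μ) (freeGen ρ ν) =
      comb ρ 1 (ρ (Equiv.swap 0 1) μ) ν := by
  rw [rightComb_eq, ← freeGen_perm, comb_apply]
  rfl

theorem relabel_cyc_pow_comb (k t : Fin 3) (μ ν : E) :
    (freeOperad ρ).relabel (cyc ^ (k : ℕ)) (comb ρ t μ ν) = comb ρ (k + t) μ ν := by
  rw [comb_apply, comb_apply, ← relabel_mul]
  congr 2
  revert k t
  unfold cyc
  decide

theorem relabel_swap_comb (t : Fin 3) (μ ν : E) :
    (freeOperad ρ).relabel (Equiv.swap 0 1) (comb ρ t μ ν) =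
      comb ρ (-t) μ (ρ (Equiv.swap 0 1) ν) := by
  have h : ∀ t : Fin 3, Equiv.swap 0 1 * cyc ^ (t : ℕ) =
      cyc ^ ((-t : Fin 3) : ℕ) * Equiv.swap 0 1 := by
    unfold cyc
    decide
  rw [comb_apply, comb_apply, ← relabel_mul, h, relabel_mul, relabel_swap_leftComb, ← freeGen_perm]

theorem relabel_swap_one_two_comb (t : Fin 3) (μ ν : E) :
    (freeOperad ρ).relabel (Equiv.swap 1 2) (comb ρ t μ ν) =
      comb ρ (2 - t) μ (ρ (Equiv.swap 0 1) ν) := by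
  have h : (Equiv.swap 1 2 : Equiv.Perm (Fin 3)) = cyc ^ ((2 : Fin 3) : ℕ) * Equiv.swap 0 1 := by
    unfold cyc
    decide
  rw [h, relabel_mul, relabel_swap_comb, relabel_cyc_pow_comb, sub_eq_add_neg]

theorem relabel_mem_permSpan {S : Set ((freeOperad ρ).obj (Fin 3))} {x : (freeOperad ρ).obj (Fin 3)}
    (hx : x ∈ permSpan ρ S) (σ : Equiv.Perm (Fin 3)) :
    (freeOperad ρ).relabel σ x ∈ permSpan ρ S := by
  have : permSpan ρ S ≤ (permSpan ρ S).comap ((freeOperad ρ).relabel σ) := by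
    refine Submodule.span_le.2 ?_
    rintro _ ⟨τ, y, hy, rfl⟩
    exact Submodule.subset_span ⟨σ * τ, y, hy, (relabel_mul _ σ τ y).symm⟩
  exact this hx

theorem subset_permSpan (S : Set ((freeOperad ρ).obj (Fin 3))) :
    S ⊆ (permSpan ρ S : Set ((freeOperad ρ).obj (Fin 3))) :=
  fun x hx => Submodule.subset_span ⟨1, x, hx, ((freeOperad ρ).relabel_refl x).symm⟩

/-- A subspace stable under the powers of the three-cycle and under one transposition is stable
under `S₃`, so it contains the sub-`S₃`-module generated by any of its subsets. -/
theorem permSpan_le {S : Set ((freeOperad ρ).obj (Fin 3))}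
    {W : Submodule K ((freeOperad ρ).obj (Fin 3))} (hS : S ⊆ W)
    (hcyc : ∀ (t : Fin 3), ∀ x ∈ W, (freeOperad ρ).relabel (cyc ^ (t : ℕ)) x ∈ W)
    (hswap : ∀ x ∈ W, (freeOperad ρ).relabel (Equiv.swap 0 1) x ∈ W) : permSpan ρ S ≤ W := by
  refine Submodule.span_le.2 ?_
  rintro _ ⟨π, x, hx, rfl⟩
  obtain ⟨t, rfl | rfl⟩ := perm_three_eq π
  · exact hcyc t x (hS hx)
  · rw [relabel_mul]
    exact hcyc t _ (hswap x (hS hx))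

/-- The space `F(E)(3)` is the direct sum of three copies of `E ⊗ E`. -/
def cubicEquiv : (Fin 3 → E ⊗[K] E) ≃ₗ[K] (freeOperad ρ).obj (Fin 3) :=
  LinearEquiv.ofBijective (cubicMap ρ) (cubicMap_bijective ρ)

theorem cubic_hom_ext {V : Type w} [AddCommGroup V] [Module K V]
    {f g : (freeOperad ρ).obj (Fin 3) →ₗ[K] V}
    (h : ∀ t μ ν, f (comb ρ t μ ν) = g (comb ρ t μ ν)) : f = g := by
  refine LinearMap.ext fun x => ?_
  obtain ⟨x, rfl⟩ := cubicMap_surjective (ρ := ρ) x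
  have : f ∘ₗ cubicMap ρ = g ∘ₗ cubicMap ρ := by
    refine LinearMap.pi_ext' fun t => TensorProduct.ext' fun μ ν => ?_
    have := h t μ ν
    rw [← cubicMap_single_eq_comb] at this
    exact this
  exact LinearMap.congr_fun this x

end Comb

/-! ### The relations of symmetric Leibniz algebras -/

section Leibniz

open SymOperad

variable (K : Type u) [Field K]

/-- The functional `μ ⊗ ν ↦ [,]^*(μ) [,]^*(ν)` on `E ⊗ E`. -/
def lieSq : OneOp K ⊗[K] OneOp K →ₗ[K] K :=
  TensorProduct.dualDistrib K _ _ (lieGenDual K ⊗ₜ lieGenDual K)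

/-- The coefficients in an element of `F(E)(3)` of the iterated brackets `[[x₀, x₁], x₂]`,
`[[x₁, x₂], x₀]`, `[[x₂, x₀], x₁]`. -/
def lieCoeff : (freeOperad (oneOp K)).obj (Fin 3) →ₗ[K] (Fin 3 → K) :=
  (LinearMap.pi fun t => lieSq K ∘ₗ LinearMap.proj t) ∘ₗ (cubicEquiv (oneOp K)).symm.toLinearMap

variable {K}

theorem lieCoeff_cubicMap (g : Fin 3 → OneOp K ⊗[K] OneOp K) (t : Fin 3) :
    lieCoeff K (cubicMap (oneOp K) g) t = lieSq K (g t) := by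
  have h : (cubicEquiv (oneOp K)).symm (cubicMap (oneOp K) g) = g :=
    (cubicEquiv (oneOp K)).symm_apply_apply g
  change lieSq K ((cubicEquiv (oneOp K)).symm (cubicMap (oneOp K) g) t) = _
  rw [h]

theorem lieCoeff_comb (t s : Fin 3) (μ ν : OneOp K) :
    lieCoeff K (comb (oneOp K) t μ ν) s =
      if s = t then lieGenDual K μ * lieGenDual K ν else 0 := by
  rw [← cubicMap_single_eq_comb, lieCoeff_cubicMap, Pi.single_apply]
  split_ifs
  · rfl
  · exact map_zero _

theorem lieGenDual_swap (x : OneOp K) :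
    lieGenDual K (oneOp K (Equiv.swap 0 1) x) = -lieGenDual K x := by
  have h : (Equiv.swap (0 : Fin 2) 1) ≠ 1 := by decide
  conv_lhs => rw [oneOp_eq x, map_add, map_smul, map_smul, oneOp_swap_mulGen, oneOp_swap_mulOpGen]
  rw [mulOpGen_eq]
  simp [lieGenDual, mulGen, h, h.symm]
  ring

theorem lieCoeff_relabel_cyc_pow (k s : Fin 3) (x : (freeOperad (oneOp K)).obj (Fin 3)) :
    lieCoeff K ((freeOperad (oneOp K)).relabel (cyc ^ (k : ℕ)) x) s = lieCoeff K x (s - k) := by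
  have : LinearMap.proj s ∘ₗ lieCoeff K ∘ₗ (freeOperad (oneOp K)).relabel (cyc ^ (k : ℕ)) =
      LinearMap.proj (s - k) ∘ₗ lieCoeff K := by
    refine cubic_hom_ext _ fun t μ ν => ?_
    change lieCoeff K ((freeOperad (oneOp K)).relabel (cyc ^ (k : ℕ)) (comb (oneOp K) t μ ν)) s =
      lieCoeff K (comb (oneOp K) t μ ν) (s - k)
    rw [relabel_cyc_pow_comb, lieCoeff_comb, lieCoeff_comb]
    simp only [sub_eq_iff_eq_add, add_comm]
  exact LinearMap.congr_fun this x

theorem lieCoeff_relabel_swap (s : Fin 3) (x : (freeOperad (oneOp K)).obj (Fin 3)) :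
    lieCoeff K ((freeOperad (oneOp K)).relabel (Equiv.swap 0 1) x) s = -lieCoeff K x (-s) := by
  have : LinearMap.proj s ∘ₗ lieCoeff K ∘ₗ (freeOperad (oneOp K)).relabel (Equiv.swap 0 1) =
      -(LinearMap.proj (-s) ∘ₗ lieCoeff K) := by
    refine cubic_hom_ext _ fun t μ ν => ?_
    change lieCoeff K ((freeOperad (oneOp K)).relabel (Equiv.swap 0 1) (comb (oneOp K) t μ ν)) s =
      -lieCoeff K (comb (oneOp K) t μ ν) (-s)
    rw [relabel_swap_comb, lieCoeff_comb, lieCoeff_comb, lieGenDual_swap]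
    simp only [neg_eq_iff_eq_neg]
    split_ifs <;> ring
  exact LinearMap.congr_fun this x

variable (K) in
/-- The elements of `F(E)(3)` whose coefficients at the three iterated brackets are equal. -/
def equalLieCoeff : Submodule K ((freeOperad (oneOp K)).obj (Fin 3)) where
  carrier := {x | ∀ s t, lieCoeff K x s = lieCoeff K x t}
  add_mem' hx hy s t := by
    rw [map_add, Pi.add_apply, Pi.add_apply, hx s t, hy s t]
  zero_mem' s t := by rw [map_zero]; rfl
  smul_mem' c x hx s t := by
    rw [map_smul, Pi.smul_apply, Pi.smul_apply, hx s t]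

theorem leftLeibniz_eq : leftLeibniz K = comb (oneOp K) 1 (mulOpGen K) (mulGen K) -
    comb (oneOp K) 0 (mulGen K) (mulGen K) - comb (oneOp K) 2 (mulOpGen K) (mulOpGen K) := by
  unfold leftLeibniz
  simp only []
  rw [rightComb_eq_comb, leftComb_eq_comb, relabel_swap_comb, oneOp_swap_mulGen]
  rfl

theorem rightLeibniz_eq : rightLeibniz K = comb (oneOp K) 0 (mulGen K) (mulGen K) -
    comb (oneOp K) 1 (mulOpGen K) (mulGen K) - comb (oneOp K) 2 (mulGen K) (mulOpGen K) := by
  unfold rightLeibniz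
  simp only []
  rw [rightComb_eq_comb, leftComb_eq_comb, relabel_swap_one_two_comb, oneOp_swap_mulGen]
  rfl

theorem lieGenDual_mulOpGen : lieGenDual K (mulOpGen K) = -lieGenDual K (mulGen K) :=
  lieGenDual_swap _

theorem sLeibRel_le : sLeibRel K ≤ equalLieCoeff K := by
  refine permSpan_le _ ?_ (fun k x hx s t => ?_) (fun x hx s t => ?_)
  · rintro x (rfl | rfl) s t
    · rw [leftLeibniz_eq]
      fin_cases s <;> fin_cases t <;> simp [lieCoeff_comb, lieGenDual_mulOpGen]
    · rw [rightLeibniz_eq]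
      fin_cases s <;> fin_cases t <;> simp [lieCoeff_comb, lieGenDual_mulOpGen]
  · rw [lieCoeff_relabel_cyc_pow, lieCoeff_relabel_cyc_pow]
    exact hx _ _
  · rw [lieCoeff_relabel_swap, lieCoeff_relabel_swap, hx]

theorem mem_sLeibRel_relabel {x : (freeOperad (oneOp K)).obj (Fin 3)} (hx : x ∈ sLeibRel K)
    (σ : Equiv.Perm (Fin 3)) : (freeOperad (oneOp K)).relabel σ x ∈ sLeibRel K :=
  relabel_mem_permSpan _ hx σ

theorem comb_mem_sLeibRel_of_comb_zero {μ ν : OneOp K} (h : comb (oneOp K) 0 μ ν ∈ sLeibRel K)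
    (t : Fin 3) : comb (oneOp K) t μ ν ∈ sLeibRel K := by
  have := mem_sLeibRel_relabel h (cyc ^ (t : ℕ))
  rwa [relabel_cyc_pow_comb, add_zero] at this

theorem leftLeibniz_mem : leftLeibniz K ∈ sLeibRel K := subset_permSpan _ _ (Or.inl rfl)

theorem rightLeibniz_mem : rightLeibniz K ∈ sLeibRel K := subset_permSpan _ _ (Or.inr rfl)

/-- `(x · y) ◇ z = 0` in symmetric Leibniz algebras: the sum of the two Leibniz identities. -/
theorem comb_symGen_mem (t : Fin 3) (ν : OneOp K) :
    comb (oneOp K) t (symGen K) ν ∈ sLeibRel K := by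
  have h1 : comb (oneOp K) 2 (symGen K) (mulOpGen K) ∈ sLeibRel K := by
    have := (sLeibRel K).neg_mem ((sLeibRel K).add_mem leftLeibniz_mem rightLeibniz_mem)
    rw [leftLeibniz_eq, rightLeibniz_eq] at this
    convert this using 1
    rw [symGen, map_add, LinearMap.add_apply]
    abel
  have h2 : comb (oneOp K) 1 (symGen K) (mulGen K) ∈ sLeibRel K := by
    have := mem_sLeibRel_relabel h1 (Equiv.swap 0 1)
    rwa [relabel_swap_comb, oneOp_swap_mulOpGen] at this
  have h3 : ∀ t, comb (oneOp K) t (symGen K) (mulGen K) ∈ sLeibRel K := by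
    have := mem_sLeibRel_relabel h2 (cyc ^ ((2 : Fin 3) : ℕ))
    rw [relabel_cyc_pow_comb] at this
    exact comb_mem_sLeibRel_of_comb_zero this
  have h4 : ∀ t, comb (oneOp K) t (symGen K) (mulOpGen K) ∈ sLeibRel K := by
    have := mem_sLeibRel_relabel h1 (cyc ^ ((1 : Fin 3) : ℕ))
    rw [relabel_cyc_pow_comb] at this
    exact comb_mem_sLeibRel_of_comb_zero this
  rw [oneOp_eq ν, map_add, map_smul, map_smul]
  exact (sLeibRel K).add_mem ((sLeibRel K).smul_mem _ (h3 t)) ((sLeibRel K).smul_mem _ (h4 t))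

/-- `(x ◇ y) · z = 0 = z · (x ◇ y)` in symmetric Leibniz algebras: symmetrize the left Leibniz
identity in its first two, the right one in its last two variables. -/
theorem comb_mem_of_symGen_right (t : Fin 3) (μ : OneOp K) :
    comb (oneOp K) t μ (symGen K) ∈ sLeibRel K := by
  have h1 : comb (oneOp K) 0 (mulGen K) (symGen K) ∈ sLeibRel K := by
    have := (sLeibRel K).neg_mem ((sLeibRel K).add_mem leftLeibniz_mem
      (mem_sLeibRel_relabel leftLeibniz_mem (Equiv.swap 0 1)))
    rw [leftLeibniz_eq, map_sub, map_sub, relabel_swap_comb, relabel_swap_comb, relabel_swap_comb,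
      oneOp_swap_mulGen, oneOp_swap_mulOpGen] at this
    convert this using 1
    rw [symGen, map_add, show (-1 : Fin 3) = 2 from rfl, show (-2 : Fin 3) = 1 from rfl,
      show (-0 : Fin 3) = 0 from rfl]
    abel
  have h2 : comb (oneOp K) 1 (mulOpGen K) (symGen K) ∈ sLeibRel K := by
    have := (sLeibRel K).neg_mem ((sLeibRel K).add_mem rightLeibniz_mem
      (mem_sLeibRel_relabel rightLeibniz_mem (Equiv.swap 1 2)))
    rw [rightLeibniz_eq, map_sub, map_sub, relabel_swap_one_two_comb, relabel_swap_one_two_comb,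
      relabel_swap_one_two_comb, oneOp_swap_mulGen, oneOp_swap_mulOpGen] at this
    convert this using 1
    rw [symGen, map_add, show (2 - 0 : Fin 3) = 2 from rfl, show (2 - 1 : Fin 3) = 1 from rfl,
      show (2 - 2 : Fin 3) = 0 from rfl]
    abel
  have h3 : ∀ t, comb (oneOp K) t (mulOpGen K) (symGen K) ∈ sLeibRel K := by
    have := mem_sLeibRel_relabel h2 (cyc ^ ((2 : Fin 3) : ℕ))
    rw [relabel_cyc_pow_comb] at this
    exact comb_mem_sLeibRel_of_comb_zero this
  rw [oneOp_eq μ, map_add, map_smul, map_smul, LinearMap.add_apply, LinearMap.smul_apply,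
    LinearMap.smul_apply]
  exact (sLeibRel K).add_mem
    ((sLeibRel K).smul_mem _ (comb_mem_sLeibRel_of_comb_zero h1 t))
    ((sLeibRel K).smul_mem _ (h3 t))

variable [CharZero K]

/-- Modulo the Leibniz relations, a cubic operation only depends on its iterated brackets. -/
theorem comb_sub_mem (t : Fin 3) (μ ν : OneOp K) : comb (oneOp K) t μ ν -
    (lieGenDual K μ * lieGenDual K ν) • comb (oneOp K) t (lieGen K) (lieGen K) ∈ sLeibRel K := by
  have h : comb (oneOp K) t μ ν -
      (lieGenDual K μ * lieGenDual K ν) • comb (oneOp K) t (lieGen K) (lieGen K) =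
      symGenDual K ν • comb (oneOp K) t μ (symGen K) +
      (lieGenDual K ν * symGenDual K μ) • comb (oneOp K) t (symGen K) (lieGen K) := by
    conv_lhs => enter [1]; rw [oneOp_eq_lie_sym ν, map_add, map_smul, map_smul]
    conv_lhs => enter [1, 1, 2]; rw [oneOp_eq_lie_sym μ]
    simp only [map_add, map_smul, LinearMap.add_apply, LinearMap.smul_apply]
    module
  rw [h]
  exact (sLeibRel K).add_mem ((sLeibRel K).smul_mem _ (comb_mem_of_symGen_right t μ))
    ((sLeibRel K).smul_mem _ (comb_symGen_mem t _))

/-- The Jacobi identity holds in symmetric Leibniz algebras. -/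
theorem jacobi_mem : ∑ t, comb (oneOp K) t (lieGen K) (lieGen K) ∈ sLeibRel K := by
  have hm : lieGenDual K (mulGen K) = 1 / 2 := by
    simp [lieGenDual, mulGen]
  have h1 := comb_sub_mem 1 (mulOpGen K) (mulGen K)
  have h0 := comb_sub_mem 0 (mulGen K) (mulGen K)
  have h2 := comb_sub_mem 2 (mulOpGen K) (mulOpGen K)
  have h := leftLeibniz_mem (K := K)
  rw [leftLeibniz_eq] at h
  rw [lieGenDual_mulOpGen, hm] at *
  have := (sLeibRel K).smul_mem 4 ((sLeibRel K).sub_mem ((sLeibRel K).sub_mem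
    ((sLeibRel K).sub_mem h1 h0) h2) h)
  convert this using 1
  rw [Fin.sum_univ_three]
  module

/-- The relations of symmetric Leibniz algebras are cut out by the equality of the coefficients of
the three iterated brackets. -/
theorem sLeibRel_eq : sLeibRel K = equalLieCoeff K := by
  refine le_antisymm sLeibRel_le fun x hx => ?_
  have key : ∀ x : (freeOperad (oneOp K)).obj (Fin 3),
      x - ∑ t, lieCoeff K x t • comb (oneOp K) t (lieGen K) (lieGen K) ∈ sLeibRel K := by
    intro x
    have h : (sLeibRel K).mkQ ∘ₗ (LinearMap.id - ∑ t, (LinearMap.proj t ∘ₗ lieCoeff K).smulRight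
        (comb (oneOp K) t (lieGen K) (lieGen K))) = 0 := by
      refine cubic_hom_ext _ fun t μ ν => ?_
      have h1 := comb_sub_mem t μ ν
      rw [← Submodule.Quotient.mk_eq_zero] at h1
      convert h1 using 1
      · simp [lieCoeff_comb]
      · rfl
    have h2 := LinearMap.congr_fun h x
    rw [← Submodule.Quotient.mk_eq_zero]
    convert h2 using 1
    · simp
    · rfl
  have h2 : ∑ t, lieCoeff K x t • comb (oneOp K) t (lieGen K) (lieGen K) =
      lieCoeff K x 0 • ∑ t, comb (oneOp K) t (lieGen K) (lieGen K) := by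
    rw [Finset.smul_sum]
    exact Finset.sum_congr rfl fun t _ => by rw [hx t 0]
  have h3 := (sLeibRel K).add_mem (key x) ((sLeibRel K).smul_mem (lieCoeff K x 0) jacobi_mem)
  rwa [h2, sub_add_cancel] at h3

end Leibniz

/-! ### Dimensions and the orthogonal complement -/

section Orth

open SymOperad

variable (K : Type u) [Field K]

theorem finrank_oneOp : Module.finrank K (OneOp K) = 2 := by
  rw [LinearEquiv.finrank_eq (MonoidAlgebra.coeffLinearEquiv K), Module.finrank_finsupp_self]
  simp [Fintype.card_perm]

instance : Module.Finite K (OneOp K) :=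
  Module.finite_of_finrank_eq_succ (finrank_oneOp K)

theorem finrank_cubic : Module.finrank K ((freeOperad (oneOp K)).obj (Fin 3)) = 12 := by
  rw [← (cubicEquiv (oneOp K)).finrank_eq, Module.finrank_pi_fintype]
  simp [Module.finrank_tensorProduct, finrank_oneOp]

/-- The two differences of coefficients that vanish on the relations of symmetric Leibniz
algebras. -/
def lieCoeffDiff : (freeOperad (oneOp K)).obj (Fin 3) →ₗ[K] K × K :=
  LinearMap.prod
    ((LinearMap.proj (R := K) (φ := fun _ => K) 0 - LinearMap.proj 1) ∘ₗ lieCoeff K)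
    ((LinearMap.proj (R := K) (φ := fun _ => K) 0 - LinearMap.proj 2) ∘ₗ lieCoeff K)

variable {K}

theorem lieCoeffDiff_apply (x : (freeOperad (oneOp K)).obj (Fin 3)) : lieCoeffDiff K x =
    (lieCoeff K x 0 - lieCoeff K x 1, lieCoeff K x 0 - lieCoeff K x 2) := rfl

theorem equalLieCoeff_eq_ker : equalLieCoeff K = LinearMap.ker (lieCoeffDiff K) := by
  ext x
  rw [LinearMap.mem_ker, lieCoeffDiff_apply, Prod.mk_eq_zero, sub_eq_zero, sub_eq_zero]
  refine ⟨fun h => ⟨h _ _, h _ _⟩, fun ⟨h1, h2⟩ s t => ?_⟩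
  have h : ∀ t, lieCoeff K x t = lieCoeff K x 0 := by
    intro t
    fin_cases t
    · rfl
    · exact h1.symm
    · exact h2.symm
  rw [h s, h t]

variable (K) in
/-- The pairing of three copies of `E^* ⊗ E^*` with three copies of `E ⊗ E`, as a linear map to the
dual space. -/
def cubicPairingLin : (Fin 3 → Module.Dual K (OneOp K) ⊗[K] Module.Dual K (OneOp K)) →ₗ[K]
    Module.Dual K (Fin 3 → OneOp K ⊗[K] OneOp K) where
  toFun f := ∑ t, TensorProduct.dualDistrib K _ _ (f t) ∘ₗ LinearMap.proj t
  map_add' f f' := by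
    simp [LinearMap.add_comp, Finset.sum_add_distrib]
  map_smul' c f := by
    simp [LinearMap.smul_comp, Finset.smul_sum]

theorem cubicPairingLin_apply (f : Fin 3 → Module.Dual K (OneOp K) ⊗[K] Module.Dual K (OneOp K))
    (g : Fin 3 → OneOp K ⊗[K] OneOp K) :
    cubicPairingLin K f g = cubicPairing K (OneOp K) f g := by
  simp [cubicPairingLin, cubicPairing]

theorem cubicPairing_single (t : Fin 3) (α β : Module.Dual K (OneOp K))
    (g : Fin 3 → OneOp K ⊗[K] OneOp K) :
    cubicPairingLin K (Pi.single t (α ⊗ₜ β)) g = TensorProduct.dualDistrib K _ _ (α ⊗ₜ β) (g t) := by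
  rw [cubicPairingLin_apply, cubicPairing, Finset.sum_eq_single t]
  · rw [Pi.single_eq_same]
  · intro s _ hs
    rw [Pi.single_eq_of_ne hs, map_zero, LinearMap.zero_apply]
  · simp

theorem cubicPairingLin_injective : Function.Injective (cubicPairingLin K) := by
  rw [injective_iff_map_eq_zero]
  intro f hf
  funext t
  apply (TensorProduct.dualDistribEquiv K (OneOp K) (OneOp K)).injective
  rw [Pi.zero_apply, map_zero]
  refine LinearMap.ext fun x => ?_
  have h := LinearMap.congr_fun hf (Pi.single t x)
  rw [cubicPairingLin_apply, cubicPairing, Finset.sum_eq_single t] at h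
  · rw [Pi.single_eq_same] at h
    exact h
  · intro s _ hs
    rw [Pi.single_eq_of_ne hs, map_zero]
  · simp

variable (K) in
/-- The element `t - (1 2 3)t` of three copies of `E^∨ ⊗ E^∨`, for `t` the square of `[,]^*`, when
`i = 1`, and `t - (3 2 1)t` when `i = 2`. -/
def lieDualDiff (i : Fin 3) : Fin 3 → Module.Dual K (OneOp K) ⊗[K] Module.Dual K (OneOp K) :=
  -- scaling by `-1` in place of a subtraction only involves the additive monoid `E^∨ ⊗ E^∨`
  let single (t : Fin 3) : Fin 3 → Module.Dual K (OneOp K) ⊗[K] Module.Dual K (OneOp K) :=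
    Pi.single t (lieGenDual K ⊗ₜ lieGenDual K)
  single 0 + (-1 : K) • single i

theorem cubicPairingLin_lieDualDiff (i : Fin 3) (g : Fin 3 → OneOp K ⊗[K] OneOp K) :
    cubicPairingLin K (lieDualDiff K i) g =
      lieCoeff K (cubicMap (oneOp K) g) 0 - lieCoeff K (cubicMap (oneOp K) g) i := by
  rw [lieDualDiff, map_add, map_smul, LinearMap.add_apply, LinearMap.smul_apply,
    cubicPairing_single, cubicPairing_single, lieCoeff_cubicMap, lieCoeff_cubicMap, neg_one_smul,
    ← sub_eq_add_neg]
  rfl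

theorem cubicMap_lieDualDiff (i : Fin 3) : cubicMap (signDual (oneOp K)) (lieDualDiff K i) =
    comb (signDual (oneOp K)) 0 (lieGenDual K) (lieGenDual K) -
      comb (signDual (oneOp K)) i (lieGenDual K) (lieGenDual K) := by
  rw [lieDualDiff, map_add, map_smul, neg_one_smul, ← sub_eq_add_neg, cubicMap_single_eq_comb,
    cubicMap_single_eq_comb]

theorem signDual_swap_lieGenDual :
    signDual (oneOp K) (Equiv.swap 0 1) (lieGenDual K) = lieGenDual K := by
  refine LinearMap.ext fun x => ?_
  rw [signDual_swap, lieGenDual_swap, neg_neg]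

theorem associator_lieGenDual :
    (freeOperad (signDual (oneOp K))).associator (freeGen (signDual (oneOp K)) (lieGenDual K)) =
      comb (signDual (oneOp K)) 0 (lieGenDual K) (lieGenDual K) -
        comb (signDual (oneOp K)) 1 (lieGenDual K) (lieGenDual K) := by
  rw [SymOperad.associator, leftComb_eq_comb, rightComb_eq_comb, signDual_swap_lieGenDual]

variable [CharZero K]

theorem lieCoeffDiff_surjective : Function.Surjective (lieCoeffDiff K) := by
  rintro ⟨a, b⟩
  refine ⟨-(a • comb (oneOp K) 1 (lieGen K) (lieGen K) +
    b • comb (oneOp K) 2 (lieGen K) (lieGen K)), ?_⟩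
  rw [lieCoeffDiff_apply]
  simp [lieCoeff_comb, dual_basis.1]

theorem finrank_sLeibRel : Module.finrank K (sLeibRel K) = 10 := by
  have : Module.Finite K ((freeOperad (oneOp K)).obj (Fin 3)) :=
    Module.finite_of_finrank_eq_succ (finrank_cubic K)
  have h := LinearMap.finrank_range_add_finrank_ker (lieCoeffDiff K)
  rw [LinearMap.range_eq_top.2 lieCoeffDiff_surjective, finrank_top, finrank_cubic,
    Module.finrank_prod, Module.finrank_self] at h
  rw [sLeibRel_eq, equalLieCoeff_eq_ker]
  omega

/-- The relations are the common kernel of the two coefficient differences, so the functionals that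
vanish on the relations are the combinations of these two. -/
theorem orthComplement_eq_map : orthComplement (oneOp K) (sLeibRel K) =
    (Submodule.span K {lieDualDiff K 1, lieDualDiff K 2}).map (cubicMap (signDual (oneOp K))) := by
  unfold orthComplement
  congr 1
  ext f
  constructor
  · intro hf
    let L : Fin 2 → Module.Dual K (Fin 3 → OneOp K ⊗[K] OneOp K) :=
      ![cubicPairingLin K (lieDualDiff K 1), cubicPairingLin K (lieDualDiff K 2)]
    have h1 : cubicPairingLin K f ∈ Submodule.span K (Set.range L) := by
      refine mem_span_of_iInf_ker_le_ker fun g hg => ?_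
      rw [Submodule.mem_iInf] at hg
      have h1 := hg 0
      have h2 := hg 1
      simp only [L, LinearMap.mem_ker, Matrix.cons_val_zero, Matrix.cons_val_one] at h1 h2
      rw [cubicPairingLin_lieDualDiff] at h1 h2
      rw [LinearMap.mem_ker, cubicPairingLin_apply]
      refine hf g ?_
      rw [sLeibRel_eq, equalLieCoeff_eq_ker, LinearMap.mem_ker, lieCoeffDiff_apply, h1, h2]
      rfl
    rw [Matrix.range_cons, Matrix.range_cons, Matrix.range_empty, Set.union_empty,
      Set.singleton_union, Submodule.mem_span_pair] at h1
    obtain ⟨a, b, h⟩ := h1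
    rw [← map_smul, ← map_smul, ← map_add] at h
    rw [← cubicPairingLin_injective h]
    exact Submodule.mem_span_pair.2 ⟨a, b, rfl⟩
  · intro hf g hg
    obtain ⟨a, b, rfl⟩ := Submodule.mem_span_pair.1 hf
    rw [sLeibRel_eq] at hg
    rw [← cubicPairingLin_apply, map_add, map_smul, map_smul, LinearMap.add_apply,
      LinearMap.smul_apply, LinearMap.smul_apply, cubicPairingLin_lieDualDiff,
      cubicPairingLin_lieDualDiff, sub_eq_zero.2 (hg 0 1), sub_eq_zero.2 (hg 0 2), smul_zero,
      smul_zero, add_zero]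

theorem linearIndependent_lieDualDiff :
    LinearIndependent K ![lieDualDiff K 1, lieDualDiff K 2] := by
  -- evaluate on the iterated brackets in the copies `1` and `2`
  let ev : (Fin 3 → Module.Dual K (OneOp K) ⊗[K] Module.Dual K (OneOp K)) →ₗ[K] K × K :=
    LinearMap.prod
      (Module.Dual.eval K (Fin 3 → OneOp K ⊗[K] OneOp K) (Pi.single 1 (lieGen K ⊗ₜ lieGen K)) ∘ₗ
        cubicPairingLin K)
      (Module.Dual.eval K (Fin 3 → OneOp K ⊗[K] OneOp K) (Pi.single 2 (lieGen K ⊗ₜ lieGen K)) ∘ₗ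
        cubicPairingLin K)
  have h : ∀ i, ev (lieDualDiff K i) =
      (cubicPairingLin K (lieDualDiff K i) (Pi.single 1 (lieGen K ⊗ₜ lieGen K)),
        cubicPairingLin K (lieDualDiff K i) (Pi.single 2 (lieGen K ⊗ₜ lieGen K))) := fun _ => rfl
  simp only [cubicPairingLin_lieDualDiff, cubicMap_single_eq_comb, lieCoeff_comb,
    dual_basis.1] at h
  refine LinearIndependent.of_comp ev ?_
  rw [show ev ∘ ![lieDualDiff K 1, lieDualDiff K 2] = ![(-1, 0), (0, -1)] from ?_]
  · refine LinearIndependent.pair_iff.2 fun a b hab => ?_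
    simpa using hab
  · funext i
    fin_cases i
    · exact (h 1).trans (by simp)
    · exact (h 2).trans (by simp)

theorem finrank_orthComplement :
    Module.finrank K (orthComplement (oneOp K) (sLeibRel K)) = 2 := by
  rw [orthComplement_eq_map,
    ← (Submodule.equivMapOfInjective _ (cubicMap_injective _) _).finrank_eq]
  have h := finrank_span_eq_card (linearIndependent_lieDualDiff (K := K))
  rw [Matrix.range_cons, Matrix.range_cons, Matrix.range_empty, Set.union_empty,
    Set.singleton_union] at h
  simpa using h

theorem orthComplement_eq_span :
    orthComplement (oneOp K) (sLeibRel K) = Submodule.span K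
      {comb (signDual (oneOp K)) 0 (lieGenDual K) (lieGenDual K) -
          comb (signDual (oneOp K)) 1 (lieGenDual K) (lieGenDual K),
        comb (signDual (oneOp K)) 0 (lieGenDual K) (lieGenDual K) -
          comb (signDual (oneOp K)) 2 (lieGenDual K) (lieGenDual K)} := by
  rw [orthComplement_eq_map, Submodule.map_span, Set.image_pair, cubicMap_lieDualDiff,
    cubicMap_lieDualDiff]

theorem orthComplement_eq_permSpan :
    orthComplement (oneOp K) (sLeibRel K) = permSpan (signDual (oneOp K))
      {(freeOperad (signDual (oneOp K))).associator
        (freeGen (signDual (oneOp K)) (lieGenDual K))} := by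
  set c := fun t => comb (signDual (oneOp K)) t (lieGenDual K) (lieGenDual K) with hc
  have hs : orthComplement (oneOp K) (sLeibRel K) = Submodule.span K {c 0 - c 1, c 0 - c 2} :=
    orthComplement_eq_span
  rw [hs, associator_lieGenDual]
  refine le_antisymm ?_ ?_
  · have h1 : c 0 - c 1 ∈ permSpan (signDual (oneOp K)) {c 0 - c 1} := subset_permSpan _ _ rfl
    have h2 := relabel_mem_permSpan _ h1 (cyc ^ ((2 : Fin 3) : ℕ))
    simp only [hc, map_sub, relabel_cyc_pow_comb] at h2
    rw [Submodule.span_le]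
    rintro _ (rfl | rfl)
    · exact h1
    · have := Submodule.neg_mem _ h2
      rw [neg_sub] at this
      exact this
  · have hmem : ∀ s t, c s - c t ∈ Submodule.span K {c 0 - c 1, c 0 - c 2} := by
      have h0 : ∀ t, c 0 - c t ∈ Submodule.span K {c 0 - c 1, c 0 - c 2} := by
        intro t
        fin_cases t
        · simp
        · exact Submodule.subset_span (Or.inl rfl)
        · exact Submodule.subset_span (Or.inr rfl)
      intro s t
      have := Submodule.sub_mem _ (h0 t) (h0 s)
      rwa [sub_sub_sub_cancel_left] at this
    rw [permSpan, Submodule.span_le]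
    rintro _ ⟨π, x, rfl, rfl⟩
    obtain ⟨t, rfl | rfl⟩ := perm_three_eq π
    · rw [map_sub, relabel_cyc_pow_comb, relabel_cyc_pow_comb]
      exact hmem _ _
    · rw [relabel_mul, map_sub, relabel_swap_comb, relabel_swap_comb, signDual_swap_lieGenDual,
        map_sub, relabel_cyc_pow_comb, relabel_cyc_pow_comb]
      exact hmem _ _

end Orth

/-! ### The Koszul dual of the operad of symmetric Leibniz algebras -/

section KoszulDual

open SymOperad

theorem SymOperad.Hom.app_associator {K : Type u} [Field K] {P : SymOperad.{u, v₁} K}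
    {Q : SymOperad.{u, v₂} K} (f : Hom P Q) (s : P.obj (Fin 2)) :
    f.app (Fin 3) (P.associator s) = Q.associator (f.app (Fin 2) s) := by
  rw [SymOperad.associator, SymOperad.associator, map_sub, f.app_leftComb, f.app_rightComb]

theorem associator_quadraticGen {K : Type u} [Field K] {E : Type v} [AddCommGroup E] [Module K E]
    {ρ : Representation K (Equiv.Perm (Fin 2)) E} {R : Submodule K ((freeOperad ρ).obj (Fin 3))}
    {e : E} (h : (freeOperad ρ).associator (freeGen ρ e) ∈ R) :
    (quadraticOperad ρ R).associator (quadraticGen ρ R e) = 0 := by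
  have h' := ((freeOperad ρ).quotientHom (SymOperad.Ideal.span (freeOperad ρ)
    (R : Set ((freeOperad ρ).obj (Fin 3))))).app_associator (freeGen ρ e)
  rw [quotientHom_eq_zero h] at h'
  exact h'.symm

variable (K : Type u) [Field K]

/-- The isomorphism `E^∨ → E` of `S₂`-modules with `[,]^* ↦ ◇` and `◇^* ↦ [,]`. -/
def dualToOneOp : Module.Dual K (OneOp K) →ₗ[K] OneOp K :=
  (Module.Dual.eval K _ (lieGen K)).smulRight (symGen K) +
    (Module.Dual.eval K _ (symGen K)).smulRight (lieGen K)

/-- The isomorphism `E → E^∨` of `S₂`-modules with `◇ ↦ [,]^*` and `[,] ↦ ◇^*`. -/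
def oneOpToDual : OneOp K →ₗ[K] Module.Dual K (OneOp K) :=
  (symGenDual K).smulRight (lieGenDual K) + (lieGenDual K).smulRight (symGenDual K)

variable {K}

theorem dualToOneOp_apply (f : Module.Dual K (OneOp K)) :
    dualToOneOp K f = f (lieGen K) • symGen K + f (symGen K) • lieGen K := rfl

theorem oneOpToDual_apply (x : OneOp K) :
    oneOpToDual K x = symGenDual K x • lieGenDual K + lieGenDual K x • symGenDual K := rfl

theorem dualToOneOp_swap (f : Module.Dual K (OneOp K)) :
    dualToOneOp K (signDual (oneOp K) (Equiv.swap 0 1) f) =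
      oneOp K (Equiv.swap 0 1) (dualToOneOp K f) := by
  rw [dualToOneOp_apply, dualToOneOp_apply, signDual_swap, signDual_swap, oneOp_swap_lieGen,
    oneOp_swap_symGen, map_add, map_smul, map_smul, oneOp_swap_lieGen, oneOp_swap_symGen, map_neg,
    neg_neg, neg_smul, smul_neg]

theorem symGenDual_swap (x : OneOp K) :
    symGenDual K (oneOp K (Equiv.swap 0 1) x) = symGenDual K x := by
  have h : (Equiv.swap (0 : Fin 2) 1) ≠ 1 := by decide
  conv_lhs => rw [oneOp_eq x, map_add, map_smul, map_smul, oneOp_swap_mulGen, oneOp_swap_mulOpGen]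
  rw [mulOpGen_eq]
  simp [symGenDual, mulGen, h, h.symm]
  ring

theorem signDual_swap_symGenDual :
    signDual (oneOp K) (Equiv.swap 0 1) (symGenDual K) = -symGenDual K := by
  refine LinearMap.ext fun x => ?_
  rw [signDual_swap, symGenDual_swap]
  rfl

theorem oneOpToDual_swap (x : OneOp K) :
    oneOpToDual K (oneOp K (Equiv.swap 0 1) x) =
      signDual (oneOp K) (Equiv.swap 0 1) (oneOpToDual K x) := by
  rw [oneOpToDual_apply, oneOpToDual_apply, map_add, map_smul, map_smul, signDual_swap_lieGenDual,
    signDual_swap_symGenDual, symGenDual_swap, lieGenDual_swap]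
  refine LinearMap.ext fun y => ?_
  simp

variable [CharZero K]

theorem dualToOneOp_lieGenDual : dualToOneOp K (lieGenDual K) = symGen K := by
  obtain ⟨h1, h2, -, -⟩ := dual_basis (K := K)
  rw [dualToOneOp_apply, h1, h2, one_smul, zero_smul, add_zero]

theorem dualToOneOp_symGenDual : dualToOneOp K (symGenDual K) = lieGen K := by
  obtain ⟨-, -, h1, h2⟩ := dual_basis (K := K)
  rw [dualToOneOp_apply, h1, h2, one_smul, zero_smul, zero_add]

theorem oneOpToDual_symGen : oneOpToDual K (symGen K) = lieGenDual K := by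
  obtain ⟨-, h1, -, h2⟩ := dual_basis (K := K)
  rw [oneOpToDual_apply, h1, h2, one_smul, zero_smul, add_zero]

theorem oneOpToDual_lieGen : oneOpToDual K (lieGen K) = symGenDual K := by
  obtain ⟨h1, -, h2, -⟩ := dual_basis (K := K)
  rw [oneOpToDual_apply, h1, h2, one_smul, zero_smul, zero_add]

theorem oneOpToDual_dualToOneOp (f : Module.Dual K (OneOp K)) :
    oneOpToDual K (dualToOneOp K f) = f := by
  rw [dualToOneOp_apply, map_add, map_smul, map_smul, oneOpToDual_symGen, oneOpToDual_lieGen,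
    ← dual_eq]

theorem dualToOneOp_oneOpToDual (x : OneOp K) : dualToOneOp K (oneOpToDual K x) = x := by
  rw [oneOpToDual_apply, map_add, map_smul, map_smul, dualToOneOp_lieGenDual,
    dualToOneOp_symGenDual, add_comm, ← oneOp_eq_lie_sym]

variable (K)

/-- The morphism `sLeib^! → ComAdm` with `[,]^* ↦ ◇` and `◇^* ↦ [,]`. -/
def sLeibDualToComAdm : Hom (sLeibDual K) (ComAdm K) :=
  quadraticLift (Q := quadraticOperad (oneOp K) (comAdmRel K))
    (quadraticGen (oneOp K) (comAdmRel K) ∘ₗ dualToOneOp K)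
    (equivariant_of_swap _ _ fun f => by
      rw [LinearMap.comp_apply, dualToOneOp_swap]
      exact quadraticGen_perm _ _ _)
    (fun x hx => by
      rw [orthComplement_eq_permSpan] at hx
      refine app_eq_zero_of_mem_permSpan _ ?_ hx
      rintro _ rfl
      rw [Hom.app_associator, freeLift_gen, LinearMap.comp_apply, dualToOneOp_lieGenDual]
      exact associator_quadraticGen (subset_permSpan _ _ rfl))

/-- The morphism `ComAdm → sLeib^!` with `◇ ↦ [,]^*` and `[,] ↦ ◇^*`. -/
def comAdmToSLeibDual : Hom (ComAdm K) (sLeibDual K) :=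
  quadraticLift (Q := quadraticOperad _ (orthComplement (oneOp K) (sLeibRel K)))
    (quadraticGen (signDual (oneOp K)) (orthComplement (oneOp K) (sLeibRel K)) ∘ₗ oneOpToDual K)
    (equivariant_of_swap _ _ fun f => by
      rw [LinearMap.comp_apply, oneOpToDual_swap]
      exact quadraticGen_perm _ _ _)
    (fun x hx => by
      refine app_eq_zero_of_mem_permSpan _ ?_ hx
      rintro _ rfl
      rw [Hom.app_associator, freeLift_gen, LinearMap.comp_apply, oneOpToDual_symGen]
      refine associator_quadraticGen ?_
      rw [orthComplement_eq_permSpan]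
      exact subset_permSpan _ _ rfl)

theorem sLeibDualToComAdm_gen (f : Module.Dual K (OneOp K)) :
    (sLeibDualToComAdm K).app (Fin 2) (quadraticGen (signDual (oneOp K))
      (orthComplement (oneOp K) (sLeibRel K)) f) =
      quadraticGen (oneOp K) (comAdmRel K) (dualToOneOp K f) := rfl

theorem comAdmToSLeibDual_gen (x : OneOp K) :
    (comAdmToSLeibDual K).app (Fin 2) (quadraticGen (oneOp K) (comAdmRel K) x) =
      quadraticGen (signDual (oneOp K)) (orthComplement (oneOp K) (sLeibRel K))
        (oneOpToDual K x) := rfl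

theorem sLeibDualToComAdm_isIso : (sLeibDualToComAdm K).IsIso := by
  refine Hom.isIso_of_inverse _ (comAdmToSLeibDual K) (quadratic_hom_ext fun f => ?_)
    (quadratic_hom_ext fun x => ?_)
  · refine (congrArg ((comAdmToSLeibDual K).app (Fin 2)) (sLeibDualToComAdm_gen K f)).trans ?_
    rw [comAdmToSLeibDual_gen, oneOpToDual_dualToOneOp]
    rfl
  · refine (congrArg ((sLeibDualToComAdm K).app (Fin 2)) (comAdmToSLeibDual_gen K x)).trans ?_
    rw [sLeibDualToComAdm_gen, dualToOneOp_oneOpToDual]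
    rfl

end KoszulDual

/-! ### Algebras over operads with one generating multiplication -/

section Algebras

open SymOperad

variable {K : Type u} [Field K] {A : Type w} [AddCommGroup A] [Module K A]

/-- The equivariant map `E → End(A)(2)` that sends the generator `a · b` to a given multiplication,
and the opposite generator to the opposite multiplication. -/
def oneOpAct (μ : A →ₗ[K] A →ₗ[K] A) : OneOp K →ₗ[K] (endOperad K A).obj (Fin 2) where
  toFun x := x.coeff 1 • binaryOp μ + x.coeff (Equiv.swap 0 1) • binaryOp μ.flip
  map_add' x y := by
    simp only [MonoidAlgebra.coeff_add, Finsupp.add_apply]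
    module
  map_smul' c x := by
    simp only [MonoidAlgebra.coeff_smul, Finsupp.smul_apply, RingHom.id_apply, smul_eq_mul]
    module

theorem oneOpAct_mulGen (μ : A →ₗ[K] A →ₗ[K] A) : oneOpAct μ (mulGen K) = binaryOp μ := by
  simp [oneOpAct, mulGen]

theorem oneOpAct_mulOpGen (μ : A →ₗ[K] A →ₗ[K] A) :
    oneOpAct μ (mulOpGen K) = binaryOp μ.flip := by
  have h : (Equiv.swap (0 : Fin 2) 1) ≠ 1 := by decide
  rw [mulOpGen_eq]
  simp [oneOpAct, h]

theorem oneOpAct_symGen (μ : A →ₗ[K] A →ₗ[K] A) :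
    oneOpAct μ (symGen K) = binaryOp (μ + μ.flip) := by
  rw [symGen, map_add, oneOpAct_mulGen, oneOpAct_mulOpGen, map_add]

theorem relabel_swap_binaryOp (μ : A →ₗ[K] A →ₗ[K] A) :
    (endOperad K A).relabel (Equiv.swap 0 1) (binaryOp μ) = binaryOp μ.flip := rfl

/-- Equivariant maps on the regular representation are determined by the generator. -/
theorem oneOp_map_ext {Q : SymOperad.{u, v} K} {f g : OneOp K →ₗ[K] Q.obj (Fin 2)}
    (hf : ∀ e, f (oneOp K (Equiv.swap 0 1) e) = Q.relabel (Equiv.swap 0 1) (f e))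
    (hg : ∀ e, g (oneOp K (Equiv.swap 0 1) e) = Q.relabel (Equiv.swap 0 1) (g e))
    (h : f (mulGen K) = g (mulGen K)) : f = g := by
  have h' : f (mulOpGen K) = g (mulOpGen K) := by
    rw [← oneOp_swap_mulGen, hf, hg, h]
  refine LinearMap.ext fun x => ?_
  rw [oneOp_eq x, map_add, map_add, map_smul, map_smul, map_smul, map_smul, h, h']

theorem oneOpAct_perm (μ : A →ₗ[K] A →ₗ[K] A) (σ : Equiv.Perm (Fin 2)) (e : OneOp K) :
    oneOpAct μ (oneOp K σ e) = (endOperad K A).relabel σ (oneOpAct μ e) := by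
  refine equivariant_of_swap _ _ (fun e => ?_) σ e
  rw [oneOp_eq e]
  simp only [map_add, map_smul, oneOp_swap_mulGen, oneOp_swap_mulOpGen, oneOpAct_mulGen,
    oneOpAct_mulOpGen]
  rw [relabel_swap_binaryOp, relabel_swap_binaryOp, LinearMap.flip_flip]

theorem binaryOp_mul {P : SymOperad.{u, v} K} (φ : Hom P (endOperad K A)) (p : P.obj (Fin 2)) :
    binaryOp (φ.mul p) = φ.app (Fin 2) p := by
  refine endOperad_ext fun v => ?_
  change endEval ![v 0, v 1] (φ.app (Fin 2) p) = endEval v (φ.app (Fin 2) p)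
  rw [show ![v 0, v 1] = v by funext i; fin_cases i <;> rfl]

theorem mul_eq_of_app_eq {P : SymOperad.{u, v} K} {φ : Hom P (endOperad K A)} {p : P.obj (Fin 2)}
    {μ : A →ₗ[K] A →ₗ[K] A} (h : φ.app (Fin 2) p = binaryOp μ) : φ.mul p = μ := by
  refine LinearMap.ext fun a => LinearMap.ext fun b => ?_
  change endEval ![a, b] (φ.app (Fin 2) p) = μ a b
  rw [h, endEval_binaryOp]
  rfl

/-- The algebras over an operad with one generating multiplication are the multiplications that
satisfy the relations. -/
theorem bijOn_mul (S : Set ((freeOperad (oneOp K)).obj (Fin 3))) (p : (A →ₗ[K] A →ₗ[K] A) → Prop)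
    (hp : ∀ μ : A →ₗ[K] A →ₗ[K] A,
      (∀ x ∈ S, (freeLift (oneOpAct μ) (oneOpAct_perm μ)).app (Fin 3) x = 0) ↔ p μ) :
    Set.BijOn (fun φ : Hom (quadraticOperad (oneOp K) (permSpan (oneOp K) S)) (endOperad K A) =>
      φ.mul (quadraticGen (oneOp K) (permSpan (oneOp K) S) (mulGen K))) Set.univ {μ | p μ} := by
  refine ⟨fun φ _ => ?_, fun φ _ ψ _ h => ?_, fun μ hμ => ?_⟩
  · change p _
    rw [← hp]
    intro x hx
    set ψ := φ.comp ((freeOperad (oneOp K)).quotientHom _) with hψ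
    have h : freeLift (oneOpAct (φ.mul (quadraticGen (oneOp K) (permSpan (oneOp K) S)
        (mulGen K)))) (oneOpAct_perm _) = ψ := by
      refine free_hom_ext fun e => ?_
      have h2 : oneOpAct (φ.mul (quadraticGen (oneOp K) (permSpan (oneOp K) S) (mulGen K))) =
          ψ.app (Fin 2) ∘ₗ freeGen (oneOp K) := by
        refine oneOp_map_ext (fun e => oneOpAct_perm _ _ e) (fun e => ?_) ?_
        · rw [LinearMap.comp_apply, freeGen_perm, ψ.app_relabel]
          rfl
        · rw [oneOpAct_mulGen, binaryOp_mul]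
          rfl
      exact LinearMap.congr_fun h2 e
    rw [h]
    refine (congrArg (φ.app (Fin 3)) (quotientHom_eq_zero (subset_permSpan _ _ hx))).trans ?_
    exact map_zero _
  · have hg : φ.app (Fin 2) (quadraticGen (oneOp K) (permSpan (oneOp K) S) (mulGen K)) =
        ψ.app (Fin 2) (quadraticGen (oneOp K) (permSpan (oneOp K) S) (mulGen K)) := by
      rw [← binaryOp_mul, ← binaryOp_mul]
      exact congrArg _ h
    have h2 : φ.app (Fin 2) ∘ₗ quadraticGen (oneOp K) (permSpan (oneOp K) S) =
        ψ.app (Fin 2) ∘ₗ quadraticGen (oneOp K) (permSpan (oneOp K) S) := by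
      refine oneOp_map_ext (fun e => ?_) (fun e => ?_) hg
      · rw [LinearMap.comp_apply, quadraticGen_perm, φ.app_relabel]
        rfl
      · rw [LinearMap.comp_apply, quadraticGen_perm, ψ.app_relabel]
        rfl
    exact quadratic_hom_ext fun e => LinearMap.congr_fun h2 e
  · refine ⟨quadraticLift (oneOpAct μ) (oneOpAct_perm μ) fun x hx =>
      app_eq_zero_of_mem_permSpan _ ((hp μ).2 hμ) hx, Set.mem_univ _, ?_⟩
    exact mul_eq_of_app_eq ((quadraticLift_gen _ _ _ _).trans (oneOpAct_mulGen μ))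

theorem endEval_leftLeibniz (μ : A →ₗ[K] A →ₗ[K] A) (v : Fin 3 → A) :
    endEval v ((freeLift (oneOpAct μ) (oneOpAct_perm μ)).app (Fin 3) (leftLeibniz K)) =
      μ (v 0) (μ (v 1) (v 2)) - μ (μ (v 0) (v 1)) (v 2) - μ (v 1) (μ (v 0) (v 2)) := by
  unfold leftLeibniz
  simp only [map_sub, Hom.app_relabel, Hom.app_leftComb, Hom.app_rightComb, freeLift_gen,
    oneOpAct_mulGen, endEval_relabel, endEval_leftComb, endEval_rightComb, endEval_binaryOp]
  rfl

theorem endEval_rightLeibniz (μ : A →ₗ[K] A →ₗ[K] A) (v : Fin 3 → A) :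
    endEval v ((freeLift (oneOpAct μ) (oneOpAct_perm μ)).app (Fin 3) (rightLeibniz K)) =
      μ (μ (v 0) (v 1)) (v 2) - μ (v 0) (μ (v 1) (v 2)) - μ (μ (v 0) (v 2)) (v 1) := by
  unfold rightLeibniz
  simp only [map_sub, Hom.app_relabel, Hom.app_leftComb, Hom.app_rightComb, freeLift_gen,
    oneOpAct_mulGen, endEval_relabel, endEval_leftComb, endEval_rightComb, endEval_binaryOp]
  rfl

theorem endEval_associator_binaryOp (μ : A →ₗ[K] A →ₗ[K] A) (v : Fin 3 → A) :
    endEval v ((endOperad K A).associator (binaryOp μ)) =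
      μ (μ (v 0) (v 1)) (v 2) - μ (v 0) (μ (v 1) (v 2)) := by
  rw [SymOperad.associator, map_sub, endEval_leftComb, endEval_rightComb, endEval_binaryOp]
  rfl

theorem leibniz_relations_iff (μ : A →ₗ[K] A →ₗ[K] A) :
    (∀ x ∈ ({leftLeibniz K, rightLeibniz K} : Set _),
      (freeLift (oneOpAct μ) (oneOpAct_perm μ)).app (Fin 3) x = 0) ↔ IsSymLeibniz μ := by
  constructor
  · intro h
    have hl := h _ (Or.inl rfl)
    have hr := h _ (Or.inr rfl)
    refine ⟨fun a b c => ?_, fun a b c => ?_⟩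
    · have := congrArg (endEval ![a, b, c]) hl
      rw [endEval_leftLeibniz, map_zero, sub_sub, sub_eq_zero] at this
      exact this
    · have := congrArg (endEval ![a, b, c]) hr
      rw [endEval_rightLeibniz, map_zero, sub_sub, sub_eq_zero] at this
      exact this
  · rintro ⟨hl, hr⟩ x (rfl | rfl)
    · refine endOperad_ext fun v => ?_
      rw [endEval_leftLeibniz, map_zero, sub_sub, sub_eq_zero]
      exact hl _ _ _
    · refine endOperad_ext fun v => ?_
      rw [endEval_rightLeibniz, map_zero, sub_sub, sub_eq_zero]
      exact hr _ _ _

theorem comAdm_relations_iff (μ : A →ₗ[K] A →ₗ[K] A) :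
    (∀ x ∈ ({(freeOperad (oneOp K)).associator (freeGen (oneOp K) (symGen K))} : Set _),
      (freeLift (oneOpAct μ) (oneOpAct_perm μ)).app (Fin 3) x = 0) ↔ IsComAdmissible μ := by
  have happ : (freeLift (oneOpAct μ) (oneOpAct_perm μ)).app (Fin 3)
      ((freeOperad (oneOp K)).associator (freeGen (oneOp K) (symGen K))) =
        (endOperad K A).associator (binaryOp (μ + μ.flip)) := by
    rw [Hom.app_associator, freeLift_gen, oneOpAct_symGen]
  constructor
  · intro h
    have h := h _ rfl
    rw [happ] at h
    refine ⟨fun a b => add_comm _ _, fun a b c => ?_⟩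
    have := congrArg (endEval ![a, b, c]) h
    rw [endEval_associator_binaryOp, map_zero, sub_eq_zero] at this
    exact this
  · rintro ⟨-, h⟩ x rfl
    rw [happ]
    refine endOperad_ext fun v => ?_
    rw [endEval_associator_binaryOp, map_zero, sub_eq_zero]
    exact h _ _ _

end Algebras

end

theorem mainTheorem4 (K : Type u) [Field K] [CharZero K] :
    -- `F(E)(3)` and `F(E^∨)(3)` are three copies of `E ⊗ E` and of `E^∨ ⊗ E^∨`
    Function.Bijective (cubicMap (oneOp K)) ∧
    Function.Bijective (cubicMap (signDual (oneOp K))) ∧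
    -- the dimensions of `F(E)(3)`, of `R` and of `R^⊥`
    Module.finrank K ((freeOperad (oneOp K)).obj (Fin 3)) = 12 ∧
    Module.finrank K (sLeibRel K) = 10 ∧
    Module.finrank K (orthComplement (oneOp K) (sLeibRel K)) = 2 ∧
    -- `R^⊥` is spanned by two elements, and expresses the associativity of `[,]^*`
    (let F := freeOperad (signDual (oneOp K))
     let s := freeGen (signDual (oneOp K)) (lieGenDual K)
     F.relabel (Equiv.swap 0 1) s = s ∧
     orthComplement (oneOp K) (sLeibRel K) =
        Submodule.span K
          {F.leftComb s s - F.relabel cyc (F.leftComb s s),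
           F.leftComb s s - F.relabel (cyc ^ 2) (F.leftComb s s)} ∧
     orthComplement (oneOp K) (sLeibRel K) =
        permSpan (signDual (oneOp K)) {F.associator s}) ∧
    -- the Koszul dual of `sLeib` is `ComAdm`, with `[,]^* ↦ ◇` and `◇^* ↦ [,]`
    (∃ Φ : SymOperad.Hom (sLeibDual K) (ComAdm K), Φ.IsIso ∧
      Φ.app (Fin 2) (quadraticGen (signDual (oneOp K)) (orthComplement (oneOp K) (sLeibRel K))
          (lieGenDual K)) = quadraticGen (oneOp K) (comAdmRel K) (symGen K) ∧
      Φ.app (Fin 2) (quadraticGen (signDual (oneOp K)) (orthComplement (oneOp K) (sLeibRel K))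
          (symGenDual K)) = quadraticGen (oneOp K) (comAdmRel K) (lieGen K)) ∧
    -- `sLeib` is the operad of symmetric Leibniz algebras, `ComAdm` that of com.-admissible ones
    (∀ (A : Type w) [AddCommGroup A] [Module K A],
      Set.BijOn (fun φ : SymOperad.Hom (sLeib K) (SymOperad.endOperad K A) =>
          φ.mul (quadraticGen (oneOp K) (sLeibRel K) (mulGen K)))
        Set.univ {μ | IsSymLeibniz μ}) ∧
    (∀ (A : Type w) [AddCommGroup A] [Module K A],
      Set.BijOn (fun φ : SymOperad.Hom (ComAdm K) (SymOperad.endOperad K A) =>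
          φ.mul (quadraticGen (oneOp K) (comAdmRel K) (mulGen K)))
        Set.univ {μ | IsComAdmissible μ}) := by
  refine ⟨cubicMap_bijective _, cubicMap_bijective _, finrank_cubic K, finrank_sLeibRel,
    finrank_orthComplement, ⟨?_, ?_, orthComplement_eq_permSpan⟩,
    ⟨sLeibDualToComAdm K, sLeibDualToComAdm_isIso K, ?_, ?_⟩, ?_, ?_⟩
  · rw [← freeGen_perm, signDual_swap_lieGenDual]
  · rw [orthComplement_eq_span, leftComb_eq_comb]
    have h := fun k : Fin 3 =>
      relabel_cyc_pow_comb (signDual (oneOp K)) k 0 (lieGenDual K) (lieGenDual K)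
    have h1 := h 1
    have h2 := h 2
    simp only [add_zero] at h1 h2
    rw [← h1, ← h2]
    rfl
  · rw [sLeibDualToComAdm_gen, dualToOneOp_lieGenDual]
  · rw [sLeibDualToComAdm_gen, dualToOneOp_symGenDual]
  · intro A _ _
    exact bijOn_mul _ _ leibniz_relations_iff
  · intro A _ _
    exact bijOn_mul _ _ comAdm_relations_iff
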